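/- **Conventions.** An $\mathscr F$-category is a (strict) 2-category $\mathcal A$ with a class of 1-cells, the *inerts*, containing all identities and closed under composition; $\mathcal A_{\mathsf{inert}}$ is the locally full sub-2-category on the inerts. A *cone* with vertex $a$ is a strict 2-functor $S:\mathcal J\to a\downarrow\mathcal A_{\mathsf{inert}}$ from a 2-category $\mathcal J$ (the strict coslice), and an $\mathscr F$-*sketch* is an $\mathscr F$-category together with a collection of *marked* cones. It is *locally discrete* if all its 2-cells are identities. The 2-category $\mathcal C\mathsf{at}$ of categories is regarded as an $\mathscr F$-sketch in which every 1-cell is inert and the marked cones are the (conical, strict 2-categorical) limit cones. A *pseudo-$\mathscr F$-functor* $F:\mathcal A\to\mathcal B$ is a pseudofunctor that preserves inerts, whose unitors are identities, and whose compositors $Fg\,Ff\Rightarrow F(gf)$ are identities whenever $f$ or $g$ is inert. A *pseudo-model* of an $\mathscr F$-sketch is a pseudo-$\mathscr F$-functor that sends marked cones to marked cones. A *lax-$\mathscr F$-transformation* $\eta:F\Rightarrow G$ is a lax transformation, with 2-cells $\eta_u: Gu\,\eta_a\Rightarrow \eta_b\,Fu$ for $u:a\to b$, such that $\eta_u$ is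 an identity for every inert $u$. Write $\mathcal P\mathsf{sMod}^{\mathsf{lx}}_{\mathscr F}(\mathcal A,\mathcal C\mathsf{at})$ for the 2-category of pseudo-models of $\mathcal A$ in $\mathcal C\mathsf{at}$, lax-$\mathscr F$-transformations and modifications. For an object $M$ of a 2-category $\mathcal C$, $\mathcal C\downarrow M$ denotes the strict slice 2-category: its objects are 1-cells $\varphi:P\to M$, its 1-cells are 1-cells $f$ with $\varphi' f=\varphi$, and its 2-cells are 2-cells $\alpha$ with $\varphi'\alpha$ the identity. **Theorem (lax slice theorem for $\mathscr F$-sketches).** Let $\mathsf A$ be a locally discrete $\mathscr F$-sketch and let $M:\mathsf A\to\mathcal C\mathsf{at}$ be a pseudo-model such that every category $Ma$ is discrete. Let $\mathcal E\mathsf l(M)$ be the 2-category of elements of $M$: its objects are pairs $(a,x)$ with $a\in\mathsf A$ and $x\in Ma$, its 1-cells $(a,x)\to(b,y)$ are the 1-cells $u:a\to b$ of $\mathsf A$ with $Mu(x)=y$, and its 2-cells are those of $\mathsf A$. Give it the $\mathscr F$-sketch structure in which a 1-cell is inert if and only if its underlying 1-cell in $\mathsf A$ is inert, and a cone is marked if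 and only if the projection $\pi_M:\mathcal E\mathsf l(M)\to\mathsf A$ sends it to a marked cone of $\mathsf A$. Then there is an equivalence of 2-categories $$\mathcal P\mathsf{sMod}^{\mathsf{lx}}_{\mathscr F}(\mathsf A,\mathcal C\mathsf{at})\downarrow M\;\simeq\;\mathcal P\mathsf{sMod}^{\mathsf{lx}}_{\mathscr F}(\mathcal E\mathsf l(M),\mathcal C\mathsf{at}),$$ that is, there are 2-functors in both directions whose composites are 2-naturally isomorphic to the identity 2-functors. -/

import Mathlib

open CategoryTheory Bicategory

universe wJ vJ uJ w v u w₁ v₁ u₁ w₂ v₂ u₂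

namespace EnhancedSketch

/-! ### Enhanced 2-categories and cones

A 2-category is a strict bicategory: `[Bicategory A] [Strict A]`.  An equality of 1-cells `h` is
regarded as an identity 2-cell through `eqToHom h`. -/

/-- The structure of an `ℱ`-category on a 2-category `A`: a class of 1-cells, the inerts, that
contains the identities and is closed under composition. -/
structure FCategory (A : Type u) [Bicategory.{w, v} A] [Strict A] where
  /-- The inert 1-cells. -/
  Inert : ∀ {a b : A}, (a ⟶ b) → Prop
  inert_id : ∀ a : A, Inert (𝟙 a)
  inert_comp : ∀ {a b c : A} (f : a ⟶ b) (g : b ⟶ c), Inert f → Inert g → Inert (f ≫ g)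

/-- A cone in an `ℱ`-category with vertex `a`, that is, a strict 2-functor `S : J ⥤ a ↓ A_inert`
into the strict coslice of the locally full sub-2-category of inerts.  The data are spelled out:
`S j = (leg j : a ⟶ diagram j)` with `leg j` inert, a 1-cell `u : j ⟶ k` goes to an inert 1-cell
`diagram u` under `a`, and a 2-cell `θ` goes to a 2-cell `diagram θ` whose whiskering with the leg
is the identity. -/
structure Cone {A : Type u} [Bicategory.{w, v} A] [Strict A] (𝒜 : FCategory A)
    (J : Type uJ) [Bicategory.{wJ, vJ} J] [Strict J] (a : A) where
  /-- The underlying diagram. -/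
  diagram : StrictPseudofunctor J A
  /-- The projections of the cone. -/
  leg : ∀ j : J, a ⟶ diagram.obj j
  inert_leg : ∀ j : J, 𝒜.Inert (leg j)
  inert_diagram : ∀ {j k : J} (f : j ⟶ k), 𝒜.Inert (diagram.map f)
  leg_comp : ∀ {j k : J} (f : j ⟶ k), leg j ≫ diagram.map f = leg k
  leg_whisker : ∀ {j k : J} {f g : j ⟶ k} (θ : f ⟶ g),
    leg j ◁ diagram.map₂ θ = eqToHom ((leg_comp f).trans (leg_comp g).symm)

set_option linter.checkUnivs false in
/-- An `ℱ`-sketch: an `ℱ`-category with a collection of marked cones. -/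
structure FSketch (A : Type u) [Bicategory.{w, v} A] [Strict A] extends FCategory A where
  /-- The marked cones. -/
  Marked : ∀ {J : Type uJ} [Bicategory.{wJ, vJ} J] [Strict J] {a : A},
    Cone toFCategory J a → Prop

/-! ### The sketch underlying a 2-category: all 1-cells inert, all limit cones marked -/

/-- The chordate `ℱ`-category on a 2-category: every 1-cell is inert. -/
def chordate (K : Type u) [Bicategory.{w, v} K] [Strict K] : FCategory K where
  Inert _ := True
  inert_id _ := trivial
  inert_comp _ _ _ _ := trivial

/-- A cone in a 2-category is a limit cone if it is a (conical, strict) 2-limit: for every `X`,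
composition with the legs is an isomorphism from the category `K(X, a)` to the category of
strictly 2-natural cones with vertex `X` on the diagram and modifications between them.  The first
clause is bijectivity on objects, the second is full faithfulness. -/
structure Cone.IsLimit {K : Type u} [Bicategory.{w, v} K] [Strict K]
    {J : Type uJ} [Bicategory.{wJ, vJ} J] [Strict J] {a : K} (S : Cone (chordate K) J a) :
    Prop where
  existsUnique_lift : ∀ (X : K) (c : ∀ j : J, X ⟶ S.diagram.obj j)
    (hc : ∀ {j k : J} (f : j ⟶ k), c j ≫ S.diagram.map f = c k),
    (∀ {j k : J} {f g : j ⟶ k} (θ : f ⟶ g),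
      c j ◁ S.diagram.map₂ θ = eqToHom ((hc f).trans (hc g).symm)) →
    ∃! l : X ⟶ a, ∀ j, l ≫ S.leg j = c j
  existsUnique_lift₂ : ∀ (X : K) (l m : X ⟶ a) (γ : ∀ j : J, l ≫ S.leg j ⟶ m ≫ S.leg j),
    (∀ {j k : J} (f : j ⟶ k),
      γ j ▷ S.diagram.map f =
        eqToHom (by rw [Strict.assoc, S.leg_comp]) ≫ γ k ≫
          eqToHom (by rw [Strict.assoc, S.leg_comp])) →
    ∃! β : l ⟶ m, ∀ j, β ▷ S.leg j = γ j

/-- A 2-category regarded as a chordate `ℱ`-sketch whose marked cones are all limit cones. -/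
def limitSketch (K : Type u) [Bicategory.{w, v} K] [Strict K] :
    FSketch.{wJ, vJ, uJ} K where
  toFCategory := chordate K
  Marked S := S.IsLimit

/-! ### Pseudo-`ℱ`-functors and pseudo-models -/

/-- A pseudo-`ℱ`-functor: a pseudofunctor that preserves inerts, whose unitors are identities and
whose compositors are identities whenever one of the two 1-cells is inert. -/
structure PseudoFFunctor {A : Type u₁} [Bicategory.{w₁, v₁} A] [Strict A] (𝒜 : FCategory A)
    {B : Type u₂} [Bicategory.{w₂, v₂} B] [Strict B] (ℬ : FCategory B)
    extends StrictlyUnitaryPseudofunctor A B where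
  map_inert : ∀ {a b : A} (f : a ⟶ b), 𝒜.Inert f → ℬ.Inert (map f)
  map_comp_of_inert : ∀ {a b c : A} (f : a ⟶ b) (g : b ⟶ c), 𝒜.Inert f ∨ 𝒜.Inert g →
    map (f ≫ g) = map f ≫ map g
  mapComp_of_inert : ∀ {a b c : A} (f : a ⟶ b) (g : b ⟶ c) (h : 𝒜.Inert f ∨ 𝒜.Inert g),
    mapComp f g = eqToIso (map_comp_of_inert f g h)

theorem eq_eqToHom_of_conj {C : Type u} [Category.{v} C] {x y x' y' : C} {f : x ⟶ y}
    {p : x' = x} {q : y = y'} {r : x' = y'} (h : eqToHom p ≫ f ≫ eqToHom q = eqToHom r) :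
    f = eqToHom (p.symm.trans (r.trans q.symm)) := by
  subst p q
  simpa using h

theorem comp_square {B : Type u} [Bicategory.{w, v} B] [Strict B] {x x' y y' z z' : B}
    {p : x ⟶ y} {q : x' ⟶ y'} {r : y ⟶ z} {s : y' ⟶ z'} {f : x ⟶ x'} {g : y ⟶ y'} {k : z ⟶ z'}
    (h₁ : p ≫ g = f ≫ q) (h₂ : r ≫ k = g ≫ s) : (p ≫ r) ≫ k = f ≫ q ≫ s := by
  rw [Strict.assoc, h₂, ← Strict.assoc, h₁, Strict.assoc]

theorem comp_square_eqToHom {B : Type u} [Bicategory.{w, v} B] [Strict B]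
    {x x' y y' z z' : B} {p : x ⟶ y} {q : x' ⟶ y'} {r : y ⟶ z} {s : y' ⟶ z'} {f : x ⟶ x'}
    {g : y ⟶ y'} {k : z ⟶ z'} (h₁ : p ≫ g = f ≫ q) (h₂ : r ≫ k = g ≫ s) :
    (α_ p r k).hom ≫ p ◁ eqToHom h₂ ≫ (α_ p g s).inv ≫ eqToHom h₁ ▷ s ≫ (α_ f q s).hom =
      eqToHom (comp_square h₁ h₂) := by
  simp [Strict.associator_eqToIso]

theorem unitors_eqToHom {B : Type u} [Bicategory.{w, v} B] [Strict B] {x y : B} (f : x ⟶ y) :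
    (λ_ f).hom ≫ (ρ_ f).inv = eqToHom ((Strict.id_comp f).trans (Strict.comp_id f).symm) := by
  simp [Strict.leftUnitor_eqToIso, Strict.rightUnitor_eqToIso]

section

variable {A : Type u₁} [Bicategory.{w₁, v₁} A] [Strict A] {𝒜 : FCategory A}
  {B : Type u₂} [Bicategory.{w₂, v₂} B] [Strict B] {ℬ : FCategory B}

/-- The image of a cone `S : J ⥤ a ↓ A_inert` under a pseudo-`ℱ`-functor `F`, that is, the
composite of `S` with the 2-functor `a ↓ A_inert ⥤ F a ↓ B_inert` induced by `F`. -/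
def PseudoFFunctor.mapCone (F : PseudoFFunctor 𝒜 ℬ) {J : Type uJ} [Bicategory.{wJ, vJ} J]
    [Strict J] {a : A} (S : Cone 𝒜 J a) : Cone ℬ J (F.obj a) where
  diagram :=
    { S.diagram.toStrictlyUnitaryPseudofunctor.comp F.toStrictlyUnitaryPseudofunctor with
      map_comp := fun f g => (congrArg (fun h => F.map h) (S.diagram.map_comp f g)).trans
        (F.map_comp_of_inert _ _ (Or.inl (S.inert_diagram f)))
      mapComp_eq_eqToIso := fun f g => by
        ext
        simp [S.diagram.mapComp_eq_eqToIso, PrelaxFunctor.map₂_eqToHom,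
          F.mapComp_of_inert _ _ (Or.inl (S.inert_diagram f))]
        exact eqToHom_trans _ _ }
  leg j := F.map (S.leg j)
  inert_leg j := F.map_inert _ (S.inert_leg j)
  inert_diagram f := F.map_inert _ (S.inert_diagram f)
  leg_comp {j k} f := (F.map_comp_of_inert _ _ (Or.inl (S.inert_leg j))).symm.trans
    (congrArg (fun h => F.map h) (S.leg_comp f))
  leg_whisker {j k f g} θ := by
    have h := F.map₂_whisker_left (S.leg j) (S.diagram.map₂ θ)
    rw [S.leg_whisker, PrelaxFunctor.map₂_eqToHom,
      F.mapComp_of_inert _ _ (Or.inl (S.inert_leg j)),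
      F.mapComp_of_inert _ _ (Or.inl (S.inert_leg j)), eqToIso.hom, eqToIso.inv] at h
    exact eq_eqToHom_of_conj h.symm

/-! ### Lax-`ℱ`-transformations and the 2-category of pseudo-models -/

/-- A lax-`ℱ`-transformation `η : F ⟶ G`: a lax transformation, with 2-cells
`η.naturality f : η.app a ≫ G.map f ⟶ F.map f ≫ η.app b`, that is strict on inerts. -/
@[ext]
structure LaxFTrans (F G : PseudoFFunctor 𝒜 ℬ) extends Lax.LaxTrans F.toLax G.toLax where
  naturality_of_inert : ∀ {a b : A} (f : a ⟶ b), 𝒜.Inert f →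
    ∃ h : app a ≫ G.map f = F.map f ≫ app b, naturality f = eqToHom h

end

section

variable {A : Type u₁} [Bicategory.{w₁, v₁} A] [Strict A]
  {B : Type u₂} [Bicategory.{w₂, v₂} B] [Strict B]

/-- A pseudo-model of an `ℱ`-sketch `𝒜` in an `ℱ`-sketch `𝒦`: a pseudo-`ℱ`-functor that maps
marked cones to marked cones.  These are the objects of the 2-category `PsMod^lx(𝒜, 𝒦)`. -/
structure PsModLx (𝒜 : FSketch.{wJ, vJ, uJ} A) (𝒦 : FSketch.{wJ, vJ, uJ} B) extends
    PseudoFFunctor 𝒜.toFCategory 𝒦.toFCategory where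
  marked_mapCone : ∀ {J : Type uJ} [Bicategory.{wJ, vJ} J] [Strict J] {a : A}
    (S : Cone 𝒜.toFCategory J a), 𝒜.Marked S → 𝒦.Marked (toPseudoFFunctor.mapCone S)

open scoped Lax.LaxTrans

/-- The lax transformation underlying a lax-`ℱ`-transformation, as a 1-cell in the bicategory of
lax functors, lax transformations and modifications. -/
abbrev LaxFTrans.toHom {𝒜 : FCategory A} {ℬ : FCategory B} {F G : PseudoFFunctor 𝒜 ℬ}
    (η : LaxFTrans F G) : F.toLax ⟶ G.toLax := η.toLaxTrans

/-- The identity lax-`ℱ`-transformation. -/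
def LaxFTrans.id {𝒜 : FCategory A} {ℬ : FCategory B} (F : PseudoFFunctor 𝒜 ℬ) :
    LaxFTrans F F where
  toLaxTrans := Lax.LaxTrans.id F.toLax
  naturality_of_inert f _ := ⟨_, unitors_eqToHom (F.map f)⟩

/-- The composite of lax-`ℱ`-transformations. -/
def LaxFTrans.comp {𝒜 : FCategory A} {ℬ : FCategory B} {F G H : PseudoFFunctor 𝒜 ℬ}
    (η : LaxFTrans F G) (θ : LaxFTrans G H) : LaxFTrans F H where
  toLaxTrans := Lax.LaxTrans.vComp η.toLaxTrans θ.toLaxTrans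
  naturality_of_inert {a b} f hf := by
    obtain ⟨h₁, e₁⟩ := η.naturality_of_inert f hf
    obtain ⟨h₂, e₂⟩ := θ.naturality_of_inert f hf
    refine ⟨comp_square h₁ h₂, ?_⟩
    change Lax.LaxTrans.vCompNaturality η.toLaxTrans θ.toLaxTrans f = _
    rw [Lax.LaxTrans.vCompNaturality, e₁, e₂]
    exact comp_square_eqToHom h₁ h₂

namespace PsModLx

variable {𝒜 : FSketch.{wJ, vJ, uJ} A} {𝒦 : FSketch.{wJ, vJ, uJ} B}

instance : CategoryStruct (PsModLx 𝒜 𝒦) where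
  Hom F G := LaxFTrans F.toPseudoFFunctor G.toPseudoFFunctor
  id F := LaxFTrans.id F.toPseudoFFunctor
  comp η θ := LaxFTrans.comp η θ

/-- A 2-cell of `PsMod^lx(𝒜, 𝒦)`: a modification. -/
@[ext]
structure Hom₂ {F G : PsModLx 𝒜 𝒦} (η θ : F ⟶ G) where
  /-- The underlying modification. -/
  as : Lax.LaxTrans.Modification η.toHom θ.toHom

@[simps]
instance (F G : PsModLx 𝒜 𝒦) : Category (F ⟶ G) where
  Hom η θ := Hom₂ η θ
  id η := ⟨.id η.toHom⟩
  comp Γ Θ := ⟨.vcomp Γ.as Θ.as⟩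

@[ext]
theorem hom₂_ext {F G : PsModLx 𝒜 𝒦} {η θ : F ⟶ G} {Γ Θ : η ⟶ θ}
    (h : ∀ a, Γ.as.app a = Θ.as.app a) : Γ = Θ :=
  Hom₂.ext (Lax.LaxTrans.Modification.ext (funext h))

/-- An isomorphism in the hom-category from one of underlying lax transformations. -/
@[simps]
def isoMk {F G : PsModLx 𝒜 𝒦} {η θ : F ⟶ G} (e : η.toHom ≅ θ.toHom) : η ≅ θ where
  hom := ⟨e.hom.as⟩
  inv := ⟨e.inv.as⟩
  hom_inv_id := Hom₂.ext (congrArg Lax.LaxTrans.Hom.as e.hom_inv_id)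
  inv_hom_id := Hom₂.ext (congrArg Lax.LaxTrans.Hom.as e.inv_hom_id)

/-- Left whiskering of a modification. -/
def whiskerLeft {F G H : PsModLx 𝒜 𝒦} (η : F ⟶ G) {θ ι : G ⟶ H} (Γ : θ ⟶ ι) :
    η ≫ θ ⟶ η ≫ ι :=
  Hom₂.mk (η := η ≫ θ) (θ := η ≫ ι)
    (Lax.LaxTrans.whiskerLeft η.toHom (Lax.LaxTrans.Hom.of Γ.as)).as

/-- Right whiskering of a modification. -/
def whiskerRight {F G H : PsModLx 𝒜 𝒦} {η θ : F ⟶ G} (Γ : η ⟶ θ) (ι : G ⟶ H) :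
    η ≫ ι ⟶ θ ≫ ι :=
  Hom₂.mk (η := η ≫ ι) (θ := θ ≫ ι)
    (Lax.LaxTrans.whiskerRight (Lax.LaxTrans.Hom.of Γ.as) ι.toHom).as

/-- The 2-category of pseudo-models, lax-`ℱ`-transformations and modifications. -/
instance : Bicategory (PsModLx 𝒜 𝒦) where
  whiskerLeft η _ _ Γ := whiskerLeft η Γ
  whiskerRight Γ ι := whiskerRight Γ ι
  associator η θ ι := isoMk (η := (η ≫ θ) ≫ ι) (θ := η ≫ θ ≫ ι)
    (Lax.LaxTrans.associator η.toHom θ.toHom ι.toHom)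
  leftUnitor {F _} η := isoMk (η := 𝟙 F ≫ η) (Lax.LaxTrans.leftUnitor η.toHom)
  rightUnitor {_ G} η := isoMk (η := η ≫ 𝟙 G) (Lax.LaxTrans.rightUnitor η.toHom)
  whiskerLeft_id _ _ := hom₂_ext fun _ => Bicategory.whiskerLeft_id _ _
  whiskerLeft_comp _ _ _ _ _ _ := hom₂_ext fun _ => Bicategory.whiskerLeft_comp _ _ _
  id_whiskerLeft _ := hom₂_ext fun _ => Bicategory.id_whiskerLeft _
  comp_whiskerLeft _ _ _ _ _ := hom₂_ext fun _ => Bicategory.comp_whiskerLeft _ _ _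
  id_whiskerRight _ _ := hom₂_ext fun _ => Bicategory.id_whiskerRight _ _
  comp_whiskerRight _ _ _ := hom₂_ext fun _ => Bicategory.comp_whiskerRight _ _ _
  whiskerRight_id _ := hom₂_ext fun _ => Bicategory.whiskerRight_id _
  whiskerRight_comp _ _ _ := hom₂_ext fun _ => Bicategory.whiskerRight_comp _ _ _
  whisker_assoc _ _ _ _ _ := hom₂_ext fun _ => Bicategory.whisker_assoc _ _ _
  whisker_exchange _ _ := hom₂_ext fun _ => Bicategory.whisker_exchange _ _
  pentagon _ _ _ _ := hom₂_ext fun _ => Bicategory.pentagon _ _ _ _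
  triangle _ _ := hom₂_ext fun _ => Bicategory.triangle _ _

theorem eqToHom_as_app {F G : PsModLx 𝒜 𝒦} {η θ : F ⟶ G} (h : η = θ) (a : A) :
    (eqToHom h : η ⟶ θ).as.app a =
      eqToHom (congrArg (fun τ : F ⟶ G => τ.app a) h) := by
  subst h; rfl

theorem eq_of_hom₂ {F G : PsModLx 𝒜 𝒦} {η θ : F ⟶ G} (Γ : η ⟶ θ)
    (h : ∀ a, ∃ e : η.app a = θ.app a, Γ.as.app a = eqToHom e) : η = θ := by
  obtain ⟨⟨p, m, h₁, h₂, h₃⟩, h₄⟩ := η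
  obtain ⟨⟨q, n, k₁, k₂, k₃⟩, k₄⟩ := θ
  have e : p = q := funext fun a => (h a).1
  subst e
  have e : @m = @n := by
    funext a b f
    have h₀ := Γ.as.naturality f
    obtain ⟨_, e₁⟩ := h a
    obtain ⟨_, e₂⟩ := h b
    rw [e₁, e₂] at h₀
    simpa using h₀.symm
  subst e
  rfl

theorem iso_eq_eqToIso {F G : PsModLx 𝒜 𝒦} {η θ : F ⟶ G} (Γ : η ≅ θ) (h : η = θ)
    (h' : ∀ a, ∃ e : η.app a = θ.app a, Γ.hom.as.app a = eqToHom e) : Γ = eqToIso h := by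
  ext a
  obtain ⟨e, he⟩ := h' a
  rw [he]
  exact (eqToHom_as_app h a).symm

theorem leftUnitor_app {F G : PsModLx 𝒜 𝒦} (η : F ⟶ G) (a : A) :
    ∃ e : (𝟙 F ≫ η).app a = η.app a, (λ_ η).hom.as.app a = eqToHom e :=
  ⟨Strict.id_comp (η.app a), congrArg Iso.hom (Strict.leftUnitor_eqToIso (η.app a))⟩

theorem rightUnitor_app {F G : PsModLx 𝒜 𝒦} (η : F ⟶ G) (a : A) :
    ∃ e : (η ≫ 𝟙 G).app a = η.app a, (ρ_ η).hom.as.app a = eqToHom e :=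
  ⟨Strict.comp_id (η.app a), congrArg Iso.hom (Strict.rightUnitor_eqToIso (η.app a))⟩

theorem associator_app {F G H I : PsModLx 𝒜 𝒦} (η : F ⟶ G) (θ : G ⟶ H) (ι : H ⟶ I) (a : A) :
    ∃ e : ((η ≫ θ) ≫ ι).app a = (η ≫ θ ≫ ι).app a, (α_ η θ ι).hom.as.app a = eqToHom e :=
  ⟨Strict.assoc (η.app a) (θ.app a) (ι.app a),
    congrArg Iso.hom (Strict.associator_eqToIso (η.app a) (θ.app a) (ι.app a))⟩

/-- The bicategory of pseudo-models is a 2-category. -/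
instance : Strict (PsModLx 𝒜 𝒦) where
  id_comp η := eq_of_hom₂ (λ_ η).hom (leftUnitor_app η)
  comp_id η := eq_of_hom₂ (ρ_ η).hom (rightUnitor_app η)
  assoc η θ ι := eq_of_hom₂ (α_ η θ ι).hom (associator_app η θ ι)
  leftUnitor_eqToIso η := iso_eq_eqToIso _ _ (leftUnitor_app η)
  rightUnitor_eqToIso η := iso_eq_eqToIso _ _ (rightUnitor_app η)
  associator_eqToIso η θ ι := iso_eq_eqToIso _ _ (associator_app η θ ι)

end PsModLx

end

/-! ### Slices of 2-categories -/

section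

variable {C : Type u} [Bicategory.{w, v} C] [Strict C]

/-- An object of the (strict) slice 2-category `C ↓ M`: a 1-cell into `M`. -/
structure Slice (M : C) where
  /-- The domain. -/
  obj : C
  /-- The structure 1-cell. -/
  hom : obj ⟶ M

namespace Slice

variable {M : C}

/-- A 1-cell of the slice: a 1-cell that commutes with the structure 1-cells. -/
@[ext]
structure Hom (X Y : Slice M) where
  /-- The underlying 1-cell. -/
  left : X.obj ⟶ Y.obj
  w : left ≫ Y.hom = X.hom

instance : CategoryStruct (Slice M) where
  Hom X Y := Hom X Y
  id X := Hom.mk (𝟙 X.obj) (Strict.id_comp _)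
  comp f g := Hom.mk (Hom.left f ≫ Hom.left g)
    ((Strict.assoc _ _ _).trans ((congrArg (fun h => Hom.left f ≫ h) (Hom.w g)).trans (Hom.w f)))

/-- A 2-cell of the slice: a 2-cell whose whiskering with the structure 1-cell is the identity. -/
@[ext]
structure Hom₂ {X Y : Slice M} (f g : X ⟶ Y) where
  /-- The underlying 2-cell. -/
  left : f.left ⟶ g.left
  w : left ▷ Y.hom = eqToHom (f.w.trans g.w.symm)

instance (X Y : Slice M) : Category (X ⟶ Y) where
  Hom f g := Hom₂ f g
  id f := ⟨𝟙 f.left, by simp⟩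
  comp α β := ⟨α.left ≫ β.left, by
    rw [Bicategory.comp_whiskerRight, α.w, β.w, eqToHom_trans]⟩
  id_comp _ := Hom₂.ext (Category.id_comp _)
  comp_id _ := Hom₂.ext (Category.comp_id _)
  assoc _ _ _ := Hom₂.ext (Category.assoc _ _ _)

@[ext]
theorem hom₂_ext {X Y : Slice M} {f g : X ⟶ Y} {α β : f ⟶ g} (h : α.left = β.left) : α = β :=
  Hom₂.ext h

/-- Left whiskering in the slice. -/
def whiskerLeft {X Y Z : Slice M} (f : X ⟶ Y) {g h : Y ⟶ Z} (α : g ⟶ h) : f ≫ g ⟶ f ≫ h :=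
  Hom₂.mk (f := f ≫ g) (g := f ≫ h) (f.left ◁ α.left) (by
    rw [Bicategory.whisker_assoc, α.w]
    simp [Strict.associator_eqToIso])

/-- Right whiskering in the slice. -/
def whiskerRight {X Y Z : Slice M} {f g : X ⟶ Y} (α : f ⟶ g) (h : Y ⟶ Z) : f ≫ h ⟶ g ≫ h :=
  Hom₂.mk (f := f ≫ h) (g := g ≫ h) (α.left ▷ h.left) (by
    have e := Bicategory.whiskerRight_comp α.left h.left Z.hom
    rw [whiskerRight_congr h.w, α.w] at e
    have e' := congrArg (fun t => (α_ f.left h.left Z.hom).hom ≫ t ≫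
      (α_ g.left h.left Z.hom).inv) e
    simp [Strict.associator_eqToIso] at e'
    exact e'.symm)

/-- An identity 2-cell between 1-cells with equal underlying 1-cells. -/
def isoMk {X Y : Slice M} {f g : X ⟶ Y} (h : f.left = g.left) (e : f.left ≅ g.left)
    (he : e = eqToIso h) : f ≅ g where
  hom := Hom₂.mk e.hom (by subst he; simp)
  inv := Hom₂.mk e.inv (by subst he; simp)
  hom_inv_id := Hom₂.ext e.hom_inv_id
  inv_hom_id := Hom₂.ext e.inv_hom_id

/-- The slice 2-category `C ↓ M`. -/
instance : Bicategory (Slice M) where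
  whiskerLeft f _ _ α := whiskerLeft f α
  whiskerRight α h := whiskerRight α h
  associator {X Y Z W} f g h := isoMk (f := (f ≫ g) ≫ h) (g := f ≫ g ≫ h) (Strict.assoc _ _ _)
    (α_ (Hom.left f) (Hom.left g) (Hom.left h)) (Strict.associator_eqToIso _ _ _)
  leftUnitor {X Y} f := isoMk (f := 𝟙 X ≫ f) (Strict.id_comp _)
    (λ_ (Hom.left f)) (Strict.leftUnitor_eqToIso _)
  rightUnitor {X Y} f := isoMk (f := f ≫ 𝟙 Y) (Strict.comp_id _)
    (ρ_ (Hom.left f)) (Strict.rightUnitor_eqToIso _)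
  whiskerLeft_id _ _ := Hom₂.ext (Bicategory.whiskerLeft_id _ _)
  whiskerLeft_comp _ _ _ _ _ _ := Hom₂.ext (Bicategory.whiskerLeft_comp _ _ _)
  id_whiskerLeft _ := Hom₂.ext (Bicategory.id_whiskerLeft _)
  comp_whiskerLeft _ _ _ _ _ := Hom₂.ext (Bicategory.comp_whiskerLeft _ _ _)
  id_whiskerRight _ _ := Hom₂.ext (Bicategory.id_whiskerRight _ _)
  comp_whiskerRight _ _ _ := Hom₂.ext (Bicategory.comp_whiskerRight _ _ _)
  whiskerRight_id _ := Hom₂.ext (Bicategory.whiskerRight_id _)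
  whiskerRight_comp _ _ _ := Hom₂.ext (Bicategory.whiskerRight_comp _ _ _)
  whisker_assoc _ _ _ _ _ := Hom₂.ext (Bicategory.whisker_assoc _ _ _)
  whisker_exchange _ _ := Hom₂.ext (Bicategory.whisker_exchange _ _)
  pentagon _ _ _ _ := Hom₂.ext (Bicategory.pentagon _ _ _ _)
  triangle _ _ := Hom₂.ext (Bicategory.triangle _ _)

theorem eqToHom_left {X Y : Slice M} {f g : X ⟶ Y} (h : f = g) :
    (eqToHom h : f ⟶ g).left = eqToHom (congrArg Hom.left h) := by
  subst h; rfl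

theorem iso_eq_eqToIso {X Y : Slice M} {f g : X ⟶ Y} (e : f ≅ g) (h : f = g)
    (h' : e.hom.left = eqToHom (congrArg Hom.left h)) : e = eqToIso h := by
  ext
  rw [h']
  exact (eqToHom_left h).symm

instance : Strict (Slice M) where
  id_comp _ := Hom.ext (Strict.id_comp _)
  comp_id _ := Hom.ext (Strict.comp_id _)
  assoc _ _ _ := Hom.ext (Strict.assoc _ _ _)
  leftUnitor_eqToIso _ := iso_eq_eqToIso _ _ (congrArg Iso.hom (Strict.leftUnitor_eqToIso _))
  rightUnitor_eqToIso _ := iso_eq_eqToIso _ _ (congrArg Iso.hom (Strict.rightUnitor_eqToIso _))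
  associator_eqToIso _ _ _ :=
    iso_eq_eqToIso _ _ (congrArg Iso.hom (Strict.associator_eqToIso _ _ _))

end Slice

end

/-! ### The 2-category of elements of a discrete pseudofunctor -/

section

variable {A : Type u} [Bicategory.{w, v} A]

/-- An object of the 2-category of elements `El(M)` of a pseudofunctor `M : A ⥤ Cat`: an object
`base` of `A` together with an object of `M base`. -/
structure El (M : Pseudofunctor A Cat.{v₁, u₁}) where
  /-- The underlying object. -/
  base : A
  /-- The element. -/
  elt : M.obj base

namespace El

variable {M : Pseudofunctor A Cat.{v₁, u₁}}

/-- A 1-cell `(a, x) ⟶ (b, y)` of `El(M)`: a 1-cell `f : a ⟶ b` with `M f x = y`.  This is the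
1-cell of the Grothendieck construction of `M` when the categories `M a` are discrete. -/
@[ext]
structure Hom (X Y : El M) where
  /-- The underlying 1-cell. -/
  base : X.base ⟶ Y.base
  map_elt : (M.map base).toFunctor.obj X.elt = Y.elt

variable [∀ a, IsDiscrete (M.obj a)]

theorem map_id_obj (a : A) (x : M.obj a) : (M.map (𝟙 a)).toFunctor.obj x = x :=
  obj_ext_of_isDiscrete ((M.mapId a).hom.toNatTrans.app x)

theorem map_comp_obj {a b c : A} (f : a ⟶ b) (g : b ⟶ c) (x : M.obj a) :
    (M.map (f ≫ g)).toFunctor.obj x = (M.map g).toFunctor.obj ((M.map f).toFunctor.obj x) :=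
  obj_ext_of_isDiscrete ((M.mapComp f g).hom.toNatTrans.app x)

instance : CategoryStruct (El M) where
  Hom X Y := Hom X Y
  id X := Hom.mk (𝟙 X.base) (map_id_obj _ _)
  comp f g := Hom.mk (Hom.base f ≫ Hom.base g) (by
    rw [map_comp_obj, Hom.map_elt f, Hom.map_elt g])

/-- A 2-cell of `El(M)`: a 2-cell between the underlying 1-cells. -/
@[ext]
structure Hom₂ {X Y : El M} (f g : X ⟶ Y) where
  /-- The underlying 2-cell. -/
  base : f.base ⟶ g.base

instance (X Y : El M) : Category (X ⟶ Y) where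
  Hom f g := Hom₂ f g
  id f := ⟨𝟙 f.base⟩
  comp α β := ⟨α.base ≫ β.base⟩
  id_comp _ := Hom₂.ext (Category.id_comp _)
  comp_id _ := Hom₂.ext (Category.comp_id _)
  assoc _ _ _ := Hom₂.ext (Category.assoc _ _ _)

@[ext]
theorem hom₂_ext {X Y : El M} {f g : X ⟶ Y} {α β : f ⟶ g} (h : α.base = β.base) : α = β :=
  Hom₂.ext h

/-- An isomorphism in a hom-category of `El(M)`. -/
def isoMk {X Y : El M} {f g : X ⟶ Y} (e : f.base ≅ g.base) : f ≅ g where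
  hom := ⟨e.hom⟩
  inv := ⟨e.inv⟩
  hom_inv_id := Hom₂.ext e.hom_inv_id
  inv_hom_id := Hom₂.ext e.inv_hom_id

instance : Bicategory (El M) where
  whiskerLeft f g h α := Hom₂.mk (f := f ≫ g) (g := f ≫ h) (Hom.base f ◁ Hom₂.base α)
  whiskerRight {_ _ _} f g α h := Hom₂.mk (f := f ≫ h) (g := g ≫ h) (Hom₂.base α ▷ Hom.base h)
  associator f g h := isoMk (f := (f ≫ g) ≫ h) (g := f ≫ g ≫ h)
    (α_ (Hom.base f) (Hom.base g) (Hom.base h))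
  leftUnitor {X _} f := isoMk (f := 𝟙 X ≫ f) (λ_ (Hom.base f))
  rightUnitor {_ Y} f := isoMk (f := f ≫ 𝟙 Y) (ρ_ (Hom.base f))
  whiskerLeft_id _ _ := Hom₂.ext (Bicategory.whiskerLeft_id _ _)
  whiskerLeft_comp _ _ _ _ _ _ := Hom₂.ext (Bicategory.whiskerLeft_comp _ _ _)
  id_whiskerLeft _ := Hom₂.ext (Bicategory.id_whiskerLeft _)
  comp_whiskerLeft _ _ _ _ _ := Hom₂.ext (Bicategory.comp_whiskerLeft _ _ _)
  id_whiskerRight _ _ := Hom₂.ext (Bicategory.id_whiskerRight _ _)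
  comp_whiskerRight _ _ _ := Hom₂.ext (Bicategory.comp_whiskerRight _ _ _)
  whiskerRight_id _ := Hom₂.ext (Bicategory.whiskerRight_id _)
  whiskerRight_comp _ _ _ := Hom₂.ext (Bicategory.whiskerRight_comp _ _ _)
  whisker_assoc _ _ _ _ _ := Hom₂.ext (Bicategory.whisker_assoc _ _ _)
  whisker_exchange _ _ := Hom₂.ext (Bicategory.whisker_exchange _ _)
  pentagon _ _ _ _ := Hom₂.ext (Bicategory.pentagon _ _ _ _)
  triangle _ _ := Hom₂.ext (Bicategory.triangle _ _)

theorem eqToHom_base {X Y : El M} {f g : X ⟶ Y} (h : f = g) :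
    (eqToHom h : f ⟶ g).base = eqToHom (congrArg Hom.base h) := by
  subst h; rfl

theorem iso_eq_eqToIso {X Y : El M} {f g : X ⟶ Y} (e : f ≅ g) (h : f = g)
    (h' : e.hom.base = eqToHom (congrArg Hom.base h)) : e = eqToIso h := by
  ext
  rw [h']
  exact (eqToHom_base h).symm

instance [Strict A] : Strict (El M) where
  id_comp _ := Hom.ext (Strict.id_comp _)
  comp_id _ := Hom.ext (Strict.comp_id _)
  assoc _ _ _ := Hom.ext (Strict.assoc _ _ _)
  leftUnitor_eqToIso _ := iso_eq_eqToIso _ _ (congrArg Iso.hom (Strict.leftUnitor_eqToIso _))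
  rightUnitor_eqToIso _ := iso_eq_eqToIso _ _ (congrArg Iso.hom (Strict.rightUnitor_eqToIso _))
  associator_eqToIso _ _ _ :=
    iso_eq_eqToIso _ _ (congrArg Iso.hom (Strict.associator_eqToIso _ _ _))

variable (M) [Strict A]

/-- The `ℱ`-category structure on `El(M)`: a 1-cell is inert when its underlying 1-cell is. -/
def fCategory (𝒜 : FCategory A) : FCategory (El M) where
  Inert f := 𝒜.Inert f.base
  inert_id X := 𝒜.inert_id X.base
  inert_comp f g hf hg := 𝒜.inert_comp f.base g.base hf hg

/-- The projection `π : El(M) ⥤ A`, a strict 2-functor that preserves inerts. -/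
def proj (𝒜 : FCategory A) : PseudoFFunctor (fCategory M 𝒜) 𝒜 where
  obj X := X.base
  map f := f.base
  map₂ α := α.base
  mapId X := Iso.refl (𝟙 X.base)
  mapComp f g := Iso.refl (f.base ≫ g.base)
  map₂_whisker_left f g h α := by
    change f.base ◁ α.base = 𝟙 (f.base ≫ g.base) ≫ f.base ◁ α.base ≫ 𝟙 (f.base ≫ h.base)
    simp
  map₂_whisker_right {_ _ _ f g} α h := by
    change α.base ▷ h.base = 𝟙 (f.base ≫ h.base) ≫ α.base ▷ h.base ≫ 𝟙 (g.base ≫ h.base)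
    simp
  map₂_associator f g h := by
    change (α_ f.base g.base h.base).hom =
      𝟙 ((f.base ≫ g.base) ≫ h.base) ≫ 𝟙 (f.base ≫ g.base) ▷ h.base ≫
        (α_ f.base g.base h.base).hom ≫ f.base ◁ 𝟙 (g.base ≫ h.base) ≫
          𝟙 (f.base ≫ g.base ≫ h.base)
    simp
  map₂_left_unitor {X Y} f := by
    change (λ_ f.base).hom = 𝟙 (𝟙 X.base ≫ f.base) ≫ 𝟙 (𝟙 X.base) ▷ f.base ≫ (λ_ f.base).hom
    simp
  map₂_right_unitor {X Y} f := by
    change (ρ_ f.base).hom = 𝟙 (f.base ≫ 𝟙 Y.base) ≫ f.base ◁ 𝟙 (𝟙 Y.base) ≫ (ρ_ f.base).hom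
    simp
  map_id _ := rfl
  mapId_eq_eqToIso _ := rfl
  map_inert _ hf := hf
  map_comp_of_inert _ _ _ := rfl
  mapComp_of_inert _ _ _ := rfl

/-- The `ℱ`-sketch structure on `El(M)`: the marked cones are those that the projection maps to
marked cones. -/
def sketch (𝒜 : FSketch.{wJ, vJ, uJ} A) : FSketch.{wJ, vJ, uJ} (El M) where
  toFCategory := fCategory M 𝒜.toFCategory
  Marked S := 𝒜.Marked ((proj M 𝒜.toFCategory).mapCone S)

end El

end

/-! ### Equivalences of 2-categories -/

section

variable {B : Type u₁} [Bicategory.{w₁, v₁} B] [Strict B]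
  {C : Type u₂} [Bicategory.{w₂, v₂} C] [Strict C]

/-- An isomorphism between 2-functors: a strictly 2-natural transformation whose components are
isomorphisms. -/
structure TwoNatIso (F G : StrictPseudofunctor B C) where
  /-- The components. -/
  app : ∀ X : B, F.obj X ⟶ G.obj X
  /-- The inverses of the components. -/
  inv : ∀ X : B, G.obj X ⟶ F.obj X
  app_inv : ∀ X : B, app X ≫ inv X = 𝟙 (F.obj X)
  inv_app : ∀ X : B, inv X ≫ app X = 𝟙 (G.obj X)
  naturality : ∀ {X Y : B} (f : X ⟶ Y), F.map f ≫ app Y = app X ≫ G.map f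
  naturality₂ : ∀ {X Y : B} {f g : X ⟶ Y} (α : f ⟶ g),
    F.map₂ α ▷ app Y ≫ eqToHom (naturality g) = eqToHom (naturality f) ≫ app X ◁ G.map₂ α

variable (B C) in
/-- An equivalence of 2-categories: 2-functors in both directions that are mutually inverse up to
isomorphism of 2-functors. -/
structure TwoEquivalence where
  /-- The forward 2-functor. -/
  functor : StrictPseudofunctor B C
  /-- The backward 2-functor. -/
  inverse : StrictPseudofunctor C B
  /-- The unit. -/
  unitIso : TwoNatIso (StrictPseudofunctor.id B) (functor.comp inverse)
  /-- The counit. -/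
  counitIso : TwoNatIso (inverse.comp functor) (StrictPseudofunctor.id C)

end

end EnhancedSketch

/-!
The equivalence is given by the 2-functor `fiberTwoFunctor`, which maps a lax-`ℱ`-transformation
`φ : P ⟶ M` to the pseudo-model `(a, x) ↦ (φ a)⁻¹ x` of its strict fibres.  By
`IsoSection.twoEquivalence` it suffices that this 2-functor is bijective on 1-cells and on 2-cells
and surjective on objects up to isomorphism; the inverse 2-functor and the two
natural isomorphisms are then forced.

Bijectivity on 1-cells and 2-cells (`isLocalIso_fiberTwoFunctor`) holds because `M a` is discrete:
a category over a discrete category has no morphisms between different fibres, so a functor over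
`M a` is the same as a family of functors between the fibres, and likewise for natural
transformations.  Since the lax transformations into `M` have trivial 2-cells, a family of
functors `φ a` that is compatible with the action of 1-cells on objects is all there is to `φ`, and
the naturality 2-cell of a lax transformation `P ⟶ Q` over `M` at `u : a ⟶ b`, restricted to the
fibre over `x`, is the naturality 2-cell at `u : (a, x) ⟶ (b, M u x)`.

For surjectivity up to isomorphism (`isoSectionFiberTwoFunctor`), a pseudo-model `N` on `El(M)` is
summed up to the pseudofunctor `totalFunctor N`, which maps `a` to the disjoint union of the
categories `N (a, x)` and projects to `M`.  Its compositor at a pair of 1-cells is on each summand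
that of `N`, so that its coherence, which by local discreteness of `A` is essentially the
associativity law `totalComp_assoc`, is that of `N` on every summand.  The fibres of this
projection give back `N` up to an isomorphism of categories, strictly naturally.

That both constructions preserve models rests on `Cone.IsPointwiseLimit`: a cone of categories is
a 2-limit if and only if compatible families of objects and of morphisms lift uniquely.  In this
form, the limit property of a cone of fibres is read off from those of `P` and `M`, and the one
of a cone of disjoint unions from those of `M`, which determines the summand, and of `N`.
-/

namespace EnhancedSketch

/-! ### Whiskering in strict bicategories up to heterogeneous equality -/

section

variable {B : Type u} [Bicategory.{w, v} B]

theorem whiskerLeft_heq {a b c : B} {f f' : a ⟶ b} {g g' h h' : b ⟶ c} {α : g ⟶ h}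
    {β : g' ⟶ h'} (hf : f = f') (hg : g = g') (hh : h = h') (e : α ≍ β) :
    f ◁ α ≍ f' ◁ β := by
  subst hf hg hh
  cases e
  rfl

theorem whiskerRight_heq {a b c : B} {f f' g g' : a ⟶ b} {h h' : b ⟶ c} {α : f ⟶ g}
    {β : f' ⟶ g'} (hf : f = f') (hg : g = g') (hh : h = h') (e : α ≍ β) :
    α ▷ h ≍ β ▷ h' := by
  subst hf hg hh
  cases e
  rfl

variable [Strict B]

theorem id_whiskerLeft_heq {a b : B} {f g : a ⟶ b} (α : f ⟶ g) : 𝟙 a ◁ α ≍ α := by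
  rw [Bicategory.id_whiskerLeft]
  simp [Strict.leftUnitor_eqToIso]

theorem whiskerRight_id_heq {a b : B} {f g : a ⟶ b} (α : f ⟶ g) : α ▷ 𝟙 b ≍ α := by
  rw [Bicategory.whiskerRight_id]
  simp [Strict.rightUnitor_eqToIso]

theorem comp_whiskerLeft_heq {a b c d : B} (f : a ⟶ b) (g : b ⟶ c) {h k : c ⟶ d}
    (α : h ⟶ k) : (f ≫ g) ◁ α ≍ f ◁ g ◁ α := by
  rw [Bicategory.comp_whiskerLeft]
  simp [Strict.associator_eqToIso]

theorem whiskerRight_comp_heq {a b c d : B} {f g : a ⟶ b} (α : f ⟶ g) (h : b ⟶ c)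
    (k : c ⟶ d) : α ▷ (h ≫ k) ≍ (α ▷ h) ▷ k := by
  rw [Bicategory.whiskerRight_comp]
  simp [Strict.associator_eqToIso]

theorem whisker_assoc_heq {a b c d : B} (f : a ⟶ b) {g h : b ⟶ c} (α : g ⟶ h) (k : c ⟶ d) :
    (f ◁ α) ▷ k ≍ f ◁ α ▷ k := by
  rw [Bicategory.whisker_assoc]
  simp [Strict.associator_eqToIso]

/-- Inserting mutually inverse 1-cells between two composable 1-cells does not change the
composite. -/
theorem comp_insert {a b c d : B} {f : a ⟶ b} {i : b ⟶ c} {e : c ⟶ b} (g : b ⟶ d)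
    (h : i ≫ e = 𝟙 b) : (f ≫ i) ≫ e ≫ g = f ≫ g := by
  rw [Strict.assoc, ← Strict.assoc i, h, Strict.id_comp]

theorem whiskerLeft_insert_heq {a b c d : B} (p : a ⟶ b) {i : b ⟶ c} {e : c ⟶ b}
    (h : i ≫ e = 𝟙 b) {f g : b ⟶ d} (α : f ⟶ g) : (p ≫ i) ◁ e ◁ α ≍ p ◁ α := by
  refine (comp_whiskerLeft_heq (p ≫ i) e α).symm.trans
    (whiskerLeft_heq ?_ rfl rfl HEq.rfl)
  rw [Strict.assoc, h, Strict.comp_id]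

theorem whiskerRight_insert_heq {a b c d : B} {f g : a ⟶ b} (α : f ⟶ g) {i : b ⟶ c}
    {e : c ⟶ b} (h : i ≫ e = 𝟙 b) (k : b ⟶ d) : (α ▷ i) ▷ (e ≫ k) ≍ α ▷ k := by
  refine (whiskerRight_comp_heq α i (e ≫ k)).symm.trans
    (whiskerRight_heq rfl rfl ?_ HEq.rfl)
  rw [← Strict.assoc, h, Strict.id_comp]

end

section

variable {B : Type u₁} [Bicategory.{w₁, v₁} B] {C : Type u₂} [Bicategory.{w₂, v₂} C]
  (F : StrictPseudofunctor B C)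

theorem map₂_heq {X Y : B} {f f' g g' : X ⟶ Y} {α : f ⟶ g} {β : f' ⟶ g'} (hf : f = f')
    (hg : g = g') (e : α ≍ β) : F.map₂ α ≍ F.map₂ β := by
  subst hf hg
  cases e
  rfl

theorem map₂_whiskerLeft_heq {X Y Z : B} (f : X ⟶ Y) {g h : Y ⟶ Z} (α : g ⟶ h) :
    F.map₂ (f ◁ α) ≍ F.map f ◁ F.map₂ α := by
  rw [F.map₂_whisker_left, F.mapComp_eq_eqToIso, F.mapComp_eq_eqToIso]
  simp

theorem map₂_whiskerRight_heq {X Y Z : B} {f g : X ⟶ Y} (α : f ⟶ g) (h : Y ⟶ Z) :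
    F.map₂ (α ▷ h) ≍ F.map₂ α ▷ F.map h := by
  rw [F.map₂_whisker_right, F.mapComp_eq_eqToIso, F.mapComp_eq_eqToIso]
  simp

theorem map₂_conj_heq {X Y : B} {f f' g g' : X ⟶ Y} (α : f ⟶ g) (hf : f' = f) (hg : g = g') :
    F.map₂ (eqToHom hf ≫ α ≫ eqToHom hg) ≍ F.map₂ α := by
  subst hf hg
  simp

/-! ### Recognizing equivalences of 2-categories -/

/-- A 2-functor is a local isomorphism if its actions on hom-categories are isomorphisms of
categories. -/
structure IsLocalIso : Prop where
  map_bijective : ∀ X Y : B, Function.Bijective (fun f : X ⟶ Y => F.map f)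
  map₂_bijective : ∀ {X Y : B} (f g : X ⟶ Y),
    Function.Bijective (fun α : f ⟶ g => F.map₂ α)

/-- The data that exhibit a 2-functor as surjective on objects up to isomorphism. -/
structure IsoSection where
  /-- The chosen preimage of an object. -/
  obj : C → B
  /-- The isomorphism from the image of the preimage. -/
  hom : ∀ N : C, F.obj (obj N) ⟶ N
  /-- The inverse isomorphism. -/
  inv : ∀ N : C, N ⟶ F.obj (obj N)
  hom_inv : ∀ N : C, hom N ≫ inv N = 𝟙 _
  inv_hom : ∀ N : C, inv N ≫ hom N = 𝟙 _

variable {F}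

theorem IsLocalIso.exists_map₂_heq (hF : IsLocalIso F) {X Y : B} {f g : X ⟶ Y}
    {p q : F.obj X ⟶ F.obj Y} (hp : F.map f = p) (hq : F.map g = q) (γ : p ⟶ q) :
    ∃ β : f ⟶ g, F.map₂ β ≍ γ := by
  subst hp hq
  obtain ⟨β, rfl⟩ := (hF.map₂_bijective f g).2 γ
  exact ⟨β, HEq.rfl⟩

theorem IsLocalIso.eq_of_heq (hF : IsLocalIso F) {X Y : B} {f g : X ⟶ Y} {β γ : f ⟶ g}
    (h : F.map₂ β ≍ F.map₂ γ) : β = γ :=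
  (hF.map₂_bijective f g).1 (_root_.eq_of_heq h)

namespace IsoSection

variable (s : IsoSection F) (hF : IsLocalIso F)

/-- The 1-cell that corresponds to the given isomorphism from an object in the image to its
chosen preimage. -/
noncomputable def unit (X : B) : X ⟶ s.obj (F.obj X) :=
  ((hF.map_bijective _ _).2 (s.inv (F.obj X))).choose

theorem map_unit (X : B) : F.map (s.unit hF X) = s.inv (F.obj X) :=
  ((hF.map_bijective _ _).2 (s.inv (F.obj X))).choose_spec

/-- The inverse of `unit`. -/
noncomputable def unitInv (X : B) : s.obj (F.obj X) ⟶ X :=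
  ((hF.map_bijective _ _).2 (s.hom (F.obj X))).choose

theorem map_unitInv (X : B) : F.map (s.unitInv hF X) = s.hom (F.obj X) :=
  ((hF.map_bijective _ _).2 (s.hom (F.obj X))).choose_spec

theorem unit_unitInv (X : B) : s.unit hF X ≫ s.unitInv hF X = 𝟙 X := by
  refine (hF.map_bijective _ _).1 ?_
  change F.map _ = F.map _
  rw [F.map_comp, map_unit, map_unitInv, s.inv_hom, F.map_id]

theorem unitInv_unit (X : B) : s.unitInv hF X ≫ s.unit hF X = 𝟙 (s.obj (F.obj X)) := by
  refine (hF.map_bijective _ _).1 ?_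
  change F.map _ = F.map _
  rw [F.map_comp, map_unit, map_unitInv, s.hom_inv, F.map_id]

end IsoSection

end

section

variable {B : Type u₁} [Bicategory.{w₁, v₁} B] [Strict B]
  {C : Type u₂} [Bicategory.{w₂, v₂} C] [Strict C] {F : StrictPseudofunctor B C}

namespace IsoSection

variable (s : IsoSection F) (hF : IsLocalIso F)

/-- The 1-cell between chosen preimages that corresponds to a given 1-cell. -/
noncomputable def map {N N' : C} (g : N ⟶ N') : s.obj N ⟶ s.obj N' :=
  ((hF.map_bijective _ _).2 ((s.hom N ≫ g) ≫ s.inv N')).choose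

theorem map_map {N N' : C} (g : N ⟶ N') : F.map (s.map hF g) = (s.hom N ≫ g) ≫ s.inv N' :=
  ((hF.map_bijective _ _).2 ((s.hom N ≫ g) ≫ s.inv N')).choose_spec

/-- The 2-cell between chosen preimages that corresponds to a given 2-cell. -/
noncomputable def map₂ {N N' : C} {g h : N ⟶ N'} (α : g ⟶ h) : s.map hF g ⟶ s.map hF h :=
  (hF.exists_map₂_heq (s.map_map hF g) (s.map_map hF h) ((s.hom N ◁ α) ▷ s.inv N')).choose

theorem map₂_map₂ {N N' : C} {g h : N ⟶ N'} (α : g ⟶ h) :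
    F.map₂ (s.map₂ hF α) ≍ (s.hom N ◁ α) ▷ s.inv N' :=
  (hF.exists_map₂_heq (s.map_map hF g) (s.map_map hF h)
    ((s.hom N ◁ α) ▷ s.inv N')).choose_spec

theorem map_comp {N N' N'' : C} (g : N ⟶ N') (h : N' ⟶ N'') :
    s.map hF (g ≫ h) = s.map hF g ≫ s.map hF h := by
  refine (hF.map_bijective _ _).1 ?_
  change F.map _ = F.map _
  rw [F.map_comp, map_map, map_map, map_map, Strict.assoc (s.hom N') h, comp_insert _ (s.inv_hom _),
    Strict.assoc, Strict.assoc, Strict.assoc]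

/-- The 2-functor inverse to a 2-functor that is a local isomorphism and surjective on objects
up to isomorphism. -/
noncomputable def inverse : StrictPseudofunctor C B :=
  StrictPseudofunctor.mk''
    { obj := s.obj
      map := fun g => s.map hF g
      map₂ := fun α => s.map₂ hF α
      map₂_id := fun {N N'} g => by
        refine hF.eq_of_heq ((s.map₂_map₂ hF _).trans ?_)
        rw [F.map₂_id, Bicategory.whiskerLeft_id, Bicategory.id_whiskerRight, s.map_map]
      map₂_comp := fun {N N' g h k} α β => by
        refine hF.eq_of_heq ((s.map₂_map₂ hF _).trans ?_)
        rw [F.map₂_comp, Bicategory.whiskerLeft_comp, Bicategory.comp_whiskerRight]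
        exact heq_comp (s.map_map hF g).symm (s.map_map hF h).symm (s.map_map hF k).symm
          (s.map₂_map₂ hF α).symm (s.map₂_map₂ hF β).symm
      map_id := fun N => (hF.map_bijective _ _).1 (by
        change F.map _ = F.map _
        rw [F.map_id, s.map_map, Strict.comp_id, s.hom_inv])
      map_comp := fun g h => s.map_comp hF g h
      map₂_whisker_left := fun {N N' N''} f g h α => by
        refine hF.eq_of_heq ((s.map₂_map₂ hF _).trans (HEq.trans ?_
          (map₂_conj_heq F (s.map hF f ◁ s.map₂ hF α) _ _).symm))
        refine HEq.trans ?_ ((map₂_whiskerLeft_heq F _ _).trans (whiskerLeft_heq (s.map_map hF f)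
          (s.map_map hF g) (s.map_map hF h) (s.map₂_map₂ hF α))).symm
        refine HEq.trans ?_ (whisker_assoc_heq _ _ _)
        refine whiskerRight_heq ?_ ?_ rfl ((comp_whiskerLeft_heq _ _ _).symm.trans
          (whiskerLeft_insert_heq (s.hom N ≫ f) (s.inv_hom N') α).symm)
        all_goals rw [comp_insert _ (s.inv_hom _), Strict.assoc]
      map₂_whisker_right := fun {N N' N'' f g} α h => by
        refine hF.eq_of_heq ((s.map₂_map₂ hF _).trans (HEq.trans ?_
          (map₂_conj_heq F (s.map₂ hF α ▷ s.map hF h) _ _).symm))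
        refine HEq.trans ?_ ((map₂_whiskerRight_heq F _ _).trans (whiskerRight_heq
          (s.map_map hF f) (s.map_map hF g) (s.map_map hF h) (s.map₂_map₂ hF α))).symm
        refine HEq.trans ?_ (whiskerRight_comp_heq _ _ _).symm
        refine whiskerRight_heq ?_ ?_ rfl ((whisker_assoc_heq _ _ _).symm.trans
          (whiskerRight_insert_heq (s.hom N ◁ α) (s.inv_hom N') h).symm)
        all_goals rw [comp_insert _ (s.inv_hom _), Strict.assoc] }

theorem unit_naturality {X Y : B} (f : X ⟶ Y) :
    f ≫ s.unit hF Y = s.unit hF X ≫ s.map hF (F.map f) := by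
  refine (hF.map_bijective _ _).1 ?_
  change F.map _ = F.map _
  rw [F.map_comp, F.map_comp, map_unit, map_unit, map_map, Strict.assoc (s.hom _),
    ← Strict.assoc (s.inv _), s.inv_hom, Strict.id_comp]

theorem unit_naturality₂ {X Y : B} {f g : X ⟶ Y} (α : f ⟶ g) :
    α ▷ s.unit hF Y ≫ eqToHom (s.unit_naturality hF g) =
      eqToHom (s.unit_naturality hF f) ≫ s.unit hF X ◁ s.map₂ hF (F.map₂ α) := by
  refine hF.eq_of_heq ?_
  refine (map₂_heq F rfl (s.unit_naturality hF g).symm (comp_eqToHom_heq _ _)).trans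
    (HEq.trans ?_ (map₂_heq F (s.unit_naturality hF f).symm rfl
      (eqToHom_comp_heq (s.unit hF X ◁ s.map₂ hF (F.map₂ α)) _).symm))
  refine (map₂_whiskerRight_heq F _ _).trans
    (HEq.trans ?_ (map₂_whiskerLeft_heq F _ _).symm)
  refine (whiskerRight_heq rfl rfl (s.map_unit hF Y) HEq.rfl).trans
    (HEq.trans ?_ (whiskerLeft_heq (s.map_unit hF X) (s.map_map hF _) (s.map_map hF _)
      (s.map₂_map₂ hF _)).symm)
  refine HEq.trans (whiskerRight_heq ?_ ?_ rfl ?_) (whisker_assoc_heq _ _ _)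
  · rw [← Strict.assoc, s.inv_hom, Strict.id_comp]
  · rw [← Strict.assoc, s.inv_hom, Strict.id_comp]
  · refine (id_whiskerLeft_heq _).symm.trans (HEq.trans ?_ (comp_whiskerLeft_heq _ _ _))
    exact whiskerLeft_heq (s.inv_hom _).symm rfl rfl HEq.rfl

/-- A 2-functor that is a local isomorphism and surjective on objects up to isomorphism is an
equivalence of 2-categories. -/
noncomputable def twoEquivalence : TwoEquivalence B C where
  functor := F
  inverse := s.inverse hF
  unitIso :=
    { app := fun X => s.unit hF X
      inv := fun X => s.unitInv hF X
      app_inv := s.unit_unitInv hF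
      inv_app := s.unitInv_unit hF
      naturality := fun f => s.unit_naturality hF f
      naturality₂ := fun α => s.unit_naturality₂ hF α }
  counitIso :=
    { app := s.hom
      inv := s.inv
      app_inv := s.hom_inv
      inv_app := s.inv_hom
      naturality := fun {N N'} g => by
        change F.map (s.map hF g) ≫ s.hom N' = s.hom N ≫ g
        rw [s.map_map, Strict.assoc, s.inv_hom, Strict.comp_id]
      naturality₂ := fun {N N' f g} α => by
        refine _root_.eq_of_heq ((comp_eqToHom_heq _ _).trans
          (HEq.trans ?_ (eqToHom_comp_heq _ _).symm))
        change F.map₂ (s.map₂ hF α) ▷ s.hom N' ≍ s.hom N ◁ α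
        refine (whiskerRight_heq (s.map_map hF f) (s.map_map hF g) rfl
          (s.map₂_map₂ hF α)).trans ((whiskerRight_comp_heq _ _ _).symm.trans ?_)
        refine (whiskerRight_heq rfl rfl (s.inv_hom N') HEq.rfl).trans (whiskerRight_id_heq _) }

end IsoSection

end

/-! ### Equality of 1-cells and 2-cells in the 2-category of categories -/

section

variable {C D : Cat.{v, u}}

theorem cat_hom_hext {F G : C ⟶ D} (hobj : ∀ x, F.toFunctor.obj x = G.toFunctor.obj x)
    (hmap : ∀ (x y : C) (f : x ⟶ y), F.toFunctor.map f ≍ G.toFunctor.map f) : F = G :=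
  Cat.ext (Functor.hext hobj hmap)

theorem cat_hom₂_ext {F G : C ⟶ D} {α β : F ⟶ G}
    (h : ∀ x, α.toNatTrans.app x = β.toNatTrans.app x) : α = β :=
  Cat.Hom₂.ext (NatTrans.ext (funext h))

/-- A 2-cell of categories whose components are identities is an identity. -/
theorem cat_hom₂_eq_eqToHom {F G : C ⟶ D} (α : F ⟶ G)
    (h : ∀ x, ∃ e : F.toFunctor.obj x = G.toFunctor.obj x, α.toNatTrans.app x = eqToHom e) :
    ∃ e : F = G, α = eqToHom e := by
  choose e he using h
  have hFG : F = G := Cat.ext (CategoryTheory.Functor.ext e fun x y f => by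
    have n := α.toNatTrans.naturality f
    rw [he, he] at n
    rw [← Category.assoc, ← n, Category.assoc, eqToHom_trans, eqToHom_refl, Category.comp_id])
  exact ⟨hFG, cat_hom₂_ext fun x => by rw [he, Cat.eqToHom_app]⟩

theorem cat_hom_obj_congr {F G : C ⟶ D} (h : F = G) (x : C) :
    F.toFunctor.obj x = G.toFunctor.obj x := by rw [h]

theorem cat_hom_map_congr {F G : C ⟶ D} (h : F = G) {x y : C} (f : x ⟶ y) :
    F.toFunctor.map f ≍ G.toFunctor.map f := by rw [h]

theorem cat_eqToHom_app_heq {F G : C ⟶ D} (h : F = G) (x : C) :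
    (eqToHom h : F ⟶ G).toNatTrans.app x ≍ 𝟙 (F.toFunctor.obj x) := by
  subst h
  rfl

end

theorem eq_eqToHom_of_heq_id {C : Type u} [Category.{v} C] {x y z : C} {f : x ⟶ y} (e : x = y)
    (h : f ≍ 𝟙 z) (hz : x = z) : f = eqToHom e := by
  subst hz e
  exact eq_of_heq h

theorem functor_map_heq {C : Type u} [Category.{v} C] {D : Type u₁} [Category.{v₁} D]
    (F : C ⥤ D) {x y x' y' : C} {f : x ⟶ y} {f' : x' ⟶ y'} (hx : x = x') (hy : y = y')
    (h : f ≍ f') : F.map f ≍ F.map f' := by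
  subst hx hy
  cases h
  rfl

/-! ### Limit cones of categories are detected on objects and morphisms -/

/-- The terminal category. -/
def pointCat : Cat.{v, u} :=
  ⟨PUnit.{u + 1},
    { Hom := fun _ _ => PUnit.{v + 1}
      id := fun _ => PUnit.unit
      comp := fun _ _ => PUnit.unit }⟩

/-- The functor from the terminal category that picks out an object. -/
def pointHom {C : Cat.{v, u}} (x : C) : pointCat.{v, u} ⟶ C :=
  Cat.Hom.ofFunctor
    { obj := fun _ => x
      map := fun _ => 𝟙 x
      map_id := fun _ => rfl
      map_comp := fun _ _ => (Category.comp_id _).symm }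

/-- The natural transformation between functors from the terminal category given by a morphism. -/
def pointHom₂ {C : Cat.{v, u}} {F G : pointCat.{v, u} ⟶ C}
    (f : F.toFunctor.obj PUnit.unit ⟶ G.toFunctor.obj PUnit.unit) : F ⟶ G :=
  Cat.Hom₂.ofNatTrans
    { app := fun _ => f
      naturality := fun _ _ _ =>
        (congrArg (· ≫ f) (F.toFunctor.map_id PUnit.unit)).trans ((Category.id_comp f).trans
          ((Category.comp_id f).symm.trans
            (congrArg (f ≫ ·) (G.toFunctor.map_id PUnit.unit).symm))) }

variable {J : Type uJ} [Bicategory.{wJ, vJ} J] [Strict J] {a : Cat.{v, u}}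

/-- The limit property of a cone of categories, in terms of compatible families of objects and of
morphisms. -/
structure Cone.IsPointwiseLimit (S : Cone (chordate Cat.{v, u}) J a) : Prop where
  existsUnique_obj : ∀ y : ∀ j : J, S.diagram.obj j,
    (∀ {j k : J} (f : j ⟶ k), (S.diagram.map f).toFunctor.obj (y j) = y k) →
    (∀ {j k : J} {f g : j ⟶ k} (θ : f ⟶ g),
      (S.diagram.map₂ θ).toNatTrans.app (y j) ≍ 𝟙 (y k)) →
    ∃! x : a, ∀ j, (S.leg j).toFunctor.obj x = y j
  existsUnique_map : ∀ (x y : a)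
    (γ : ∀ j : J, (S.leg j).toFunctor.obj x ⟶ (S.leg j).toFunctor.obj y),
    (∀ {j k : J} (f : j ⟶ k), (S.diagram.map f).toFunctor.map (γ j) ≍ γ k) →
    ∃! β : x ⟶ y, ∀ j, (S.leg j).toFunctor.map β = γ j

namespace Cone

variable {S : Cone (chordate Cat.{v, u}) J a}

theorem leg_comp_obj (S : Cone (chordate Cat.{v, u}) J a) {j k : J} (f : j ⟶ k) (x : a) :
    (S.diagram.map f).toFunctor.obj ((S.leg j).toFunctor.obj x) = (S.leg k).toFunctor.obj x :=
  cat_hom_obj_congr (S.leg_comp f) x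

theorem leg_comp_map (S : Cone (chordate Cat.{v, u}) J a) {j k : J} (f : j ⟶ k) {x y : a}
    (g : x ⟶ y) :
    (S.diagram.map f).toFunctor.map ((S.leg j).toFunctor.map g) ≍ (S.leg k).toFunctor.map g :=
  cat_hom_map_congr (S.leg_comp f) g

theorem leg_whisker_app (S : Cone (chordate Cat.{v, u}) J a) {j k : J} {f g : j ⟶ k}
    (θ : f ⟶ g) (x : a) :
    (S.diagram.map₂ θ).toNatTrans.app ((S.leg j).toFunctor.obj x) ≍
      𝟙 ((S.leg k).toFunctor.obj x) := by
  have h := congrArg (fun α => α.toNatTrans.app x) (S.leg_whisker θ)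
  refine (heq_of_eq h).trans ((cat_eqToHom_app_heq _ x).trans ?_)
  rw [S.leg_comp f]

/-- Objects and morphisms of a category are functors out of the terminal category and natural
transformations between them, so the universal property need only be tested there. -/
theorem IsLimit.isPointwiseLimit (hS : S.IsLimit) : S.IsPointwiseLimit where
  existsUnique_obj y hy hθ := by
    have hc : ∀ {j k : J} (f : j ⟶ k), pointHom (y j) ≫ S.diagram.map f = pointHom (y k) := by
      intro j k f
      refine cat_hom_hext (fun _ => hy f) (fun _ _ _ => ?_)
      refine (heq_of_eq ((S.diagram.map f).toFunctor.map_id (y j))).trans ?_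
      rw [hy f]
      rfl
    obtain ⟨l, hl, hu⟩ := hS.existsUnique_lift pointCat (fun j => pointHom (y j)) hc
      (fun {j k f g} θ => cat_hom₂_ext fun x => by
        rw [Cat.eqToHom_app]
        exact eq_eqToHom_of_heq_id _ (hθ θ) (hy f))
    refine ⟨l.toFunctor.obj PUnit.unit, fun j => cat_hom_obj_congr (hl j) PUnit.unit, ?_⟩
    intro x hx
    refine cat_hom_obj_congr (hu (pointHom x) fun j => ?_) PUnit.unit
    refine cat_hom_hext (fun _ => hx j) (fun _ _ _ => ?_)
    refine (heq_of_eq ((S.leg j).toFunctor.map_id x)).trans ?_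
    rw [hx j]
    rfl
  existsUnique_map x y γ hγ := by
    obtain ⟨β, hβ, hu⟩ := hS.existsUnique_lift₂ pointCat (pointHom x) (pointHom y)
      (fun j => pointHom₂ (γ j)) (fun {j k} f => cat_hom₂_ext fun _ => by
        rw [Cat.Hom₂.comp_app, Cat.Hom₂.comp_app, Cat.eqToHom_app, Cat.eqToHom_app]
        exact (conj_eqToHom_iff_heq' _ _ _ _).2 (hγ f))
    refine ⟨β.toNatTrans.app PUnit.unit, fun j => ?_, ?_⟩
    · exact congrArg (fun α => α.toNatTrans.app PUnit.unit) (hβ j)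
    · intro δ hδ
      exact congrArg (fun α => α.toNatTrans.app PUnit.unit)
        (hu (pointHom₂ δ) fun j => cat_hom₂_ext fun _ => hδ j)

namespace IsPointwiseLimit

theorem map_ext (hS : S.IsPointwiseLimit) {x y : a} {f g : x ⟶ y}
    (h : ∀ j, (S.leg j).toFunctor.map f = (S.leg j).toFunctor.map g) : f = g :=
  (hS.existsUnique_map x y (fun j => (S.leg j).toFunctor.map g)
    (fun f => S.leg_comp_map f g)).unique h (fun _ => rfl)

theorem obj_ext (hS : S.IsPointwiseLimit) {x y : a}
    (h : ∀ j, (S.leg j).toFunctor.obj x = (S.leg j).toFunctor.obj y) : x = y :=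
  (hS.existsUnique_obj (fun j => (S.leg j).toFunctor.obj y)
    (fun f => S.leg_comp_obj f y) (fun θ => S.leg_whisker_app θ y)).unique h (fun _ => rfl)

theorem map_hext (hS : S.IsPointwiseLimit) {x y x' y' : a} {f : x ⟶ y} {g : x' ⟶ y'}
    (hx : x = x') (hy : y = y')
    (h : ∀ j, (S.leg j).toFunctor.map f ≍ (S.leg j).toFunctor.map g) : f ≍ g := by
  subst hx hy
  exact heq_of_eq (hS.map_ext fun j => eq_of_heq (h j))

theorem exists_map_heq (hS : S.IsPointwiseLimit) {x y : a} {p q : ∀ j : J, S.diagram.obj j}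
    (hx : ∀ j, (S.leg j).toFunctor.obj x = p j) (hy : ∀ j, (S.leg j).toFunctor.obj y = q j)
    (γ : ∀ j : J, p j ⟶ q j)
    (hγ : ∀ {j k : J} (f : j ⟶ k), (S.diagram.map f).toFunctor.map (γ j) ≍ γ k) :
    ∃ β : x ⟶ y, ∀ j, (S.leg j).toFunctor.map β ≍ γ j := by
  obtain rfl : (fun j => (S.leg j).toFunctor.obj x) = p := funext hx
  obtain rfl : (fun j => (S.leg j).toFunctor.obj y) = q := funext hy
  obtain ⟨β, hβ, _⟩ := hS.existsUnique_map x y γ hγ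
  exact ⟨β, fun j => heq_of_eq (hβ j)⟩

theorem isLimit (hS : S.IsPointwiseLimit) : S.IsLimit where
  existsUnique_lift X c hc hθ := by
    have hobj : ∀ x : X, ∃ y : a, ∀ j, (S.leg j).toFunctor.obj y = (c j).toFunctor.obj x := by
      intro x
      refine (hS.existsUnique_obj (fun j => (c j).toFunctor.obj x)
        (fun f => cat_hom_obj_congr (hc f) x) (fun {j k f g} θ => ?_)).exists
      have h := congrArg (fun α => α.toNatTrans.app x) (hθ θ)
      refine (heq_of_eq h).trans ((cat_eqToHom_app_heq _ x).trans ?_)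
      rw [hc f]
    choose o ho using hobj
    have hmap : ∀ {x y : X} (g : x ⟶ y), ∃ β : o x ⟶ o y,
        ∀ j, (S.leg j).toFunctor.map β ≍ (c j).toFunctor.map g := fun {x y} g =>
      hS.exists_map_heq (ho x) (ho y) (fun j => (c j).toFunctor.map g)
        (fun f => cat_hom_map_congr (hc f) g)
    choose m hm using @hmap
    let l : X ⟶ a := Cat.Hom.ofFunctor
      { obj := o
        map := fun g => m g
        map_id := fun x => hS.map_ext fun j => eq_of_heq ((hm _ j).trans (by
          rw [CategoryTheory.Functor.map_id, CategoryTheory.Functor.map_id, ho x j]))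
        map_comp := fun {x y z} f g => hS.map_ext fun j => eq_of_heq ((hm _ j).trans (by
          rw [Functor.map_comp, Functor.map_comp]
          exact heq_comp (ho x j).symm (ho y j).symm (ho z j).symm (hm f j).symm
            (hm g j).symm)) }
    refine ⟨l, fun j => cat_hom_hext (fun x => ho x j) (fun x y g => hm g j), ?_⟩
    intro l' hl'
    have e : ∀ x, l'.toFunctor.obj x = o x := fun x => hS.obj_ext fun j =>
      (cat_hom_obj_congr (hl' j) x).trans (ho x j).symm
    exact cat_hom_hext e fun x y g => hS.map_hext (e x) (e y) fun j =>
      (cat_hom_map_congr (hl' j) g).trans (hm g j).symm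
  existsUnique_lift₂ X l m γ hγ := by
    have h : ∀ x : X, ∃ β : l.toFunctor.obj x ⟶ m.toFunctor.obj x,
        ∀ j, (S.leg j).toFunctor.map β = (γ j).toNatTrans.app x := by
      intro x
      refine (hS.existsUnique_map _ _ (fun j => (γ j).toNatTrans.app x)
        (fun {j k} f => ?_)).exists
      have h := congrArg (fun α => α.toNatTrans.app x) (hγ f)
      rw [Cat.Hom₂.comp_app, Cat.Hom₂.comp_app, Cat.eqToHom_app, Cat.eqToHom_app] at h
      exact (conj_eqToHom_iff_heq' _ _ _ _).1 h
    choose b hb using h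
    refine ⟨Cat.Hom₂.ofNatTrans
      { app := b
        naturality := fun x y g => hS.map_ext fun j => by
          rw [Functor.map_comp, Functor.map_comp, hb, hb]
          exact (γ j).toNatTrans.naturality g }, fun j => cat_hom₂_ext fun x => hb x j, ?_⟩
    intro β hβ
    refine cat_hom₂_ext fun x => hS.map_ext fun j => ?_
    exact (congrArg (fun α => α.toNatTrans.app x) (hβ j)).trans (hb x j).symm

end IsPointwiseLimit

end Cone

/-! ### Fibres of functors -/

section

variable {C D C' D' : Cat.{v, u}}

/-- An object of the strict fibre of a functor `φ : C ⟶ D` over an object `x`. -/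
structure Fiber (φ : C ⟶ D) (x : D) where
  /-- The underlying object. -/
  pt : C
  mem : φ.toFunctor.obj pt = x

/-- The strict fibre as a full subcategory of the domain.  When the codomain is discrete this is
the usual fibre, since every morphism of the domain then lies over an identity. -/
instance (φ : C ⟶ D) (x : D) : Category.{v} (Fiber φ x) where
  Hom p q := p.pt ⟶ q.pt
  id p := 𝟙 p.pt
  comp f g := CategoryStruct.comp (obj := C) f g
  id_comp f := Category.id_comp (obj := C) f
  comp_id f := Category.comp_id (obj := C) f
  assoc f g h := Category.assoc (obj := C) f g h

theorem Fiber.ext {φ : C ⟶ D} {x : D} {p q : Fiber φ x} (h : p.pt = q.pt) : p = q := by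
  cases p
  cases q
  cases h
  rfl

/-- The strict fibre as an object of the 2-category of categories. -/
def fiberCat (φ : C ⟶ D) (x : D) : Cat.{v, u} :=
  Cat.of (Fiber φ x)

variable {φ : C ⟶ D} {x : D} {φ' : C' ⟶ D'} {x' : D'}

/-- The functor between fibres induced by a functor between the domains. -/
def fiberHom (G : C ⟶ C')
    (h : ∀ p, φ.toFunctor.obj p = x → φ'.toFunctor.obj (G.toFunctor.obj p) = x') :
    fiberCat φ x ⟶ fiberCat φ' x' :=
  Cat.Hom.ofFunctor
    { obj := fun p => ⟨G.toFunctor.obj p.pt, h p.pt p.mem⟩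
      map := fun {p q} f => G.toFunctor.map (X := p.pt) (Y := q.pt) f
      map_id := fun p => G.toFunctor.map_id p.pt
      map_comp := fun {p q r} f g => G.toFunctor.map_comp (X := p.pt) (Y := q.pt) (Z := r.pt) f g }

/-- The natural transformation between functors on fibres induced by a natural transformation. -/
def fiberHom₂ {G G' : C ⟶ C'} (α : G ⟶ G')
    (h : ∀ p, φ.toFunctor.obj p = x → φ'.toFunctor.obj (G.toFunctor.obj p) = x')
    (h' : ∀ p, φ.toFunctor.obj p = x → φ'.toFunctor.obj (G'.toFunctor.obj p) = x') :
    fiberHom G h ⟶ fiberHom G' h' :=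
  Cat.Hom₂.ofNatTrans
    { app := fun p => α.toNatTrans.app p.pt
      naturality := fun p q f => α.toNatTrans.naturality (X := p.pt) (Y := q.pt) f }

theorem fiberHom_congr {G G' : C ⟶ C'} (e : G = G')
    (h : ∀ p, φ.toFunctor.obj p = x → φ'.toFunctor.obj (G.toFunctor.obj p) = x')
    (h' : ∀ p, φ.toFunctor.obj p = x → φ'.toFunctor.obj (G'.toFunctor.obj p) = x') :
    fiberHom G h = fiberHom G' h' := by
  subst e
  rfl

theorem fiberHom₂_eqToHom {G G' : C ⟶ C'} (e : G = G')
    (h : ∀ p, φ.toFunctor.obj p = x → φ'.toFunctor.obj (G.toFunctor.obj p) = x')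
    (h' : ∀ p, φ.toFunctor.obj p = x → φ'.toFunctor.obj (G'.toFunctor.obj p) = x') :
    fiberHom₂ (eqToHom e) h h' = eqToHom (fiberHom_congr e h h') := by
  subst e
  rfl

/-- The natural isomorphism between functors on fibres induced by a natural isomorphism. -/
def fiberIso {G G' : C ⟶ C'} (α : G ≅ G')
    (h : ∀ p, φ.toFunctor.obj p = x → φ'.toFunctor.obj (G.toFunctor.obj p) = x')
    (h' : ∀ p, φ.toFunctor.obj p = x → φ'.toFunctor.obj (G'.toFunctor.obj p) = x') :
    fiberHom G h ≅ fiberHom G' h' where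
  hom := fiberHom₂ α.hom h h'
  inv := fiberHom₂ α.inv h' h
  hom_inv_id := congrArg (fun β => fiberHom₂ β h h) α.hom_inv_id
  inv_hom_id := congrArg (fun β => fiberHom₂ β h' h') α.inv_hom_id

theorem fiberIso_eqToIso {G G' : C ⟶ C'} (e : G = G')
    (h : ∀ p, φ.toFunctor.obj p = x → φ'.toFunctor.obj (G.toFunctor.obj p) = x')
    (h' : ∀ p, φ.toFunctor.obj p = x → φ'.toFunctor.obj (G'.toFunctor.obj p) = x') :
    fiberIso (eqToIso e) h h' = eqToIso (fiberHom_congr e h h') := by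
  subst e
  rfl

end

/-! ### The fibres of a pseudo-model over a discrete one -/

section

variable {A : Type u} [Bicategory.{w, v} A] [Strict A] {𝒜 : FCategory A}
  {P Q M : PseudoFFunctor 𝒜 (chordate Cat.{v₁, u₁})} [∀ a, IsDiscrete (M.obj a)]

/-- The components of a lax transformation with discrete codomain form a strictly commutative
square. -/
theorem LaxFTrans.map_app_obj (φ : LaxFTrans P M) {a b : A} (f : a ⟶ b) (p : P.obj a) :
    (φ.app b).toFunctor.obj ((P.map f).toFunctor.obj p) =
      (M.map f).toFunctor.obj ((φ.app a).toFunctor.obj p) :=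
  (obj_ext_of_isDiscrete (C := M.obj b) ((φ.naturality f).toNatTrans.app p)).symm

theorem LaxFTrans.map_app_obj_of_over (φ : LaxFTrans P M) {X Y : El M.toPseudofunctor}
    (f : X ⟶ Y) (p : P.obj X.base) (h : (φ.app X.base).toFunctor.obj p = X.elt) :
    (φ.app Y.base).toFunctor.obj ((P.map f.base).toFunctor.obj p) = Y.elt := by
  rw [φ.map_app_obj, h, f.map_elt]

/-- The pseudo-`ℱ`-functor on the 2-category of elements that maps `(a, x)` to the fibre of
`φ a : P a ⟶ M a` over `x`. -/
def fiberFunctor (φ : LaxFTrans P M) :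
    PseudoFFunctor (El.fCategory M.toPseudofunctor 𝒜) (chordate Cat.{v₁, u₁}) where
  obj X := fiberCat (φ.app X.base) X.elt
  map f := fiberHom (P.map f.base) (φ.map_app_obj_of_over f)
  map₂ α := fiberHom₂ (P.map₂ α.base) _ _
  map₂_id f := congrArg (fun β => fiberHom₂ β _ _) (P.map₂_id f.base)
  map₂_comp α β := congrArg (fun β => fiberHom₂ β _ _) (P.map₂_comp α.base β.base)
  mapId X := fiberIso (P.mapId X.base) (φ.map_app_obj_of_over (𝟙 X)) (fun _ h => h)
  mapComp f g := fiberIso (P.mapComp f.base g.base) (φ.map_app_obj_of_over (f ≫ g))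
    (fun p h => φ.map_app_obj_of_over g _ (φ.map_app_obj_of_over f p h))
  map₂_whisker_left f _ _ α :=
    congrArg (fun β => fiberHom₂ β _ _) (P.map₂_whisker_left f.base α.base)
  map₂_whisker_right α h :=
    congrArg (fun β => fiberHom₂ β _ _) (P.map₂_whisker_right α.base h.base)
  map₂_associator f g h :=
    congrArg (fun β => fiberHom₂ β _ _) (P.map₂_associator f.base g.base h.base)
  map₂_left_unitor f :=
    congrArg (fun β => fiberHom₂ β _ _) (P.map₂_left_unitor f.base)
  map₂_right_unitor f :=
    congrArg (fun β => fiberHom₂ β _ _) (P.map₂_right_unitor f.base)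
  map_id X := fiberHom_congr (P.map_id X.base) _ (fun _ h => h)
  mapId_eq_eqToIso X := (congrArg (fun β => fiberIso β _ _) (P.mapId_eq_eqToIso X.base)).trans
    (fiberIso_eqToIso _ _ (fun _ h => h))
  map_inert _ _ := trivial
  map_comp_of_inert f g h := fiberHom_congr (P.map_comp_of_inert f.base g.base h) _
    (fun p h => φ.map_app_obj_of_over g _ (φ.map_app_obj_of_over f p h))
  mapComp_of_inert f g h := (congrArg (fun β => fiberIso β _ _)
    (P.mapComp_of_inert f.base g.base h)).trans (fiberIso_eqToIso _ _ _)

/-- The lax-`ℱ`-transformation between the functors of fibres induced by a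
lax-`ℱ`-transformation over `M`. -/
def fiberTrans {φ : LaxFTrans P M} {ψ : LaxFTrans Q M} (η : LaxFTrans P Q)
    (h : ∀ a (p : P.obj a), (ψ.app a).toFunctor.obj ((η.app a).toFunctor.obj p) =
      (φ.app a).toFunctor.obj p) :
    LaxFTrans (fiberFunctor φ) (fiberFunctor ψ) where
  app X := fiberHom (x := X.elt) (x' := X.elt) (η.app X.base) (fun p hp => (h X.base p).trans hp)
  naturality {X Y} f := fiberHom₂ (x := X.elt) (x' := Y.elt) (η.naturality f.base)
    (fun p hp => ψ.map_app_obj_of_over f _ ((h X.base p).trans hp))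
    (fun p hp => (h Y.base _).trans (φ.map_app_obj_of_over f p hp))
  naturality_naturality {X _ _ _} α := cat_hom₂_ext fun (p : Fiber (φ.app X.base) X.elt) =>
    congrArg (fun β => Cat.Hom₂.toNatTrans β |>.app p.pt) (η.naturality_naturality α.base)
  naturality_id X := cat_hom₂_ext fun (p : Fiber (φ.app X.base) X.elt) =>
    congrArg (fun β => Cat.Hom₂.toNatTrans β |>.app p.pt) (η.naturality_id X.base)
  naturality_comp {X _ _} f g := cat_hom₂_ext fun (p : Fiber (φ.app X.base) X.elt) =>
    congrArg (fun β => Cat.Hom₂.toNatTrans β |>.app p.pt) (η.naturality_comp f.base g.base)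
  naturality_of_inert f hf := by
    obtain ⟨e, he⟩ := η.naturality_of_inert f.base hf
    exact ⟨_, (congrArg (fun β => fiberHom₂ β _ _) he).trans (fiberHom₂_eqToHom e _ _)⟩

end

/-! ### The 2-functor of fibres -/

section

variable {A : Type u} [Bicategory.{w, v} A] [Strict A] {𝒜 : FSketch.{wJ, vJ, uJ} A}
  {M : PsModLx 𝒜 (limitSketch.{wJ, vJ, uJ} Cat.{v₁, u₁})}

theorem Slice.Hom.app_obj {X Y : Slice M} (f : X ⟶ Y) (a : A) (p : X.obj.obj a) :
    (Y.hom.app a).toFunctor.obj ((f.left.app a).toFunctor.obj p) =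
      (X.hom.app a).toFunctor.obj p :=
  cat_hom_obj_congr (congrArg (fun η : X.obj ⟶ M => η.app a) f.w) p

variable [∀ a, IsDiscrete (M.obj a)]

/-- A compatible family in the fibres has a unique lift in the limit of the domains, and this lift
lies in the correct fibre because the legs of the limit in the codomain are jointly injective. -/
theorem isPointwiseLimit_fiberFunctor_mapCone {J : Type uJ} [Bicategory.{wJ, vJ} J] [Strict J]
    {P : PsModLx 𝒜 (limitSketch.{wJ, vJ, uJ} Cat.{v₁, u₁})} (φ : P ⟶ M)
    {X : El M.toPseudofunctor} (S : Cone (El.fCategory M.toPseudofunctor 𝒜.toFCategory) J X)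
    (hP : (P.toPseudoFFunctor.mapCone
      ((El.proj M.toPseudofunctor 𝒜.toFCategory).mapCone S)).IsPointwiseLimit)
    (hM : (M.toPseudoFFunctor.mapCone
      ((El.proj M.toPseudofunctor 𝒜.toFCategory).mapCone S)).IsPointwiseLimit) :
    ((fiberFunctor φ).mapCone S).IsPointwiseLimit where
  existsUnique_obj (y : ∀ j, Fiber (φ.app (S.diagram.obj j).base) (S.diagram.obj j).elt) hy hθ := by
    obtain ⟨p, hp, hu⟩ := hP.existsUnique_obj (fun j => (y j).pt)
      (fun f => congrArg Fiber.pt (hy f)) (fun θ => hθ θ)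
    have hx : (φ.app X.base).toFunctor.obj p = X.elt := hM.obj_ext fun j =>
      (LaxFTrans.map_app_obj φ (S.leg j).base p).symm.trans
        ((congrArg (φ.app _).toFunctor.obj (hp j)).trans
          ((y j).mem.trans (S.leg j).map_elt.symm))
    exact ⟨⟨p, hx⟩, fun j => Fiber.ext (hp j),
      fun q hq => Fiber.ext (hu q.pt fun j => congrArg Fiber.pt (hq j))⟩
  existsUnique_map (p q : Fiber (φ.app X.base) X.elt) γ hγ :=
    hP.existsUnique_map p.pt q.pt γ (fun f => hγ f)

/-- The pseudo-model of fibres of an object of the slice over `M`. -/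
def fiberModel (X : Slice M) :
    PsModLx (El.sketch M.toPseudofunctor 𝒜) (limitSketch.{wJ, vJ, uJ} Cat.{v₁, u₁}) where
  toPseudoFFunctor := fiberFunctor X.hom
  marked_mapCone S hS := (isPointwiseLimit_fiberFunctor_mapCone X.hom S
    (X.obj.marked_mapCone _ hS).isPointwiseLimit (M.marked_mapCone _ hS).isPointwiseLimit).isLimit

/-- The action of the 2-functor of fibres on 1-cells. -/
def fiberModelMap {X Y : Slice M} (f : X ⟶ Y) : fiberModel X ⟶ fiberModel Y :=
  fiberTrans f.left (Slice.Hom.app_obj f)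

/-- The action of the 2-functor of fibres on 2-cells. -/
def fiberModelMap₂ {X Y : Slice M} {f g : X ⟶ Y} (α : f ⟶ g) :
    fiberModelMap f ⟶ fiberModelMap g :=
  PsModLx.Hom₂.mk (η := fiberModelMap f) (θ := fiberModelMap g)
    { app := fun Z => fiberHom₂ (x := Z.elt) (x' := Z.elt) (α.left.as.app Z.base)
        (fun p hp => (Slice.Hom.app_obj f Z.base p).trans hp)
        (fun p hp => (Slice.Hom.app_obj g Z.base p).trans hp)
      naturality := fun {Z _} u => cat_hom₂_ext fun (p : Fiber (X.hom.app Z.base) Z.elt) =>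
        congrArg (fun β => Cat.Hom₂.toNatTrans β |>.app p.pt) (α.left.as.naturality u.base) }

theorem fiberModelMap₂_whiskerLeft {X Y Z : Slice M} (f : X ⟶ Y) {g h : Y ⟶ Z} (α : g ⟶ h) :
    fiberModelMap₂ (f ◁ α) = fiberModelMap f ◁ fiberModelMap₂ α :=
  rfl

theorem fiberModelMap₂_whiskerRight {X Y Z : Slice M} {f g : X ⟶ Y} (α : f ⟶ g) (h : Y ⟶ Z) :
    fiberModelMap₂ (α ▷ h) = fiberModelMap₂ α ▷ fiberModelMap h :=
  rfl

theorem fiberModelMap_id (X : Slice M) : fiberModelMap (𝟙 X) = 𝟙 (fiberModel X) :=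
  rfl

theorem fiberModelMap_comp {X Y Z : Slice M} (f : X ⟶ Y) (g : Y ⟶ Z) :
    fiberModelMap (f ≫ g) = fiberModelMap f ≫ fiberModelMap g :=
  rfl

theorem eq_eqToHom_rfl_conj {C : Type u} [Category.{v} C] {x y : C} (f : x ⟶ y) (hx : x = x)
    (hy : y = y) : f = eqToHom hx ≫ f ≫ eqToHom hy :=
  ((Category.id_comp _).trans (Category.comp_id _)).symm

variable (M) in
/-- The 2-functor that maps an object of the slice over `M` to its pseudo-model of fibres. -/
def fiberTwoFunctor : StrictPseudofunctor (Slice M)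
    (PsModLx (El.sketch M.toPseudofunctor 𝒜) (limitSketch.{wJ, vJ, uJ} Cat.{v₁, u₁})) :=
  StrictPseudofunctor.mk''
    { obj := fiberModel
      map := fun f => fiberModelMap f
      map₂ := fun α => fiberModelMap₂ α
      map₂_id := fun _ => rfl
      map₂_comp := fun _ _ => rfl
      map_id := fiberModelMap_id
      map_comp := fun f g => fiberModelMap_comp f g
      map₂_whisker_left := fun f _ _ α => (fiberModelMap₂_whiskerLeft f α).trans
        (eq_eqToHom_rfl_conj (fiberModelMap f ◁ fiberModelMap₂ α) _ _)
      map₂_whisker_right := fun α f => (fiberModelMap₂_whiskerRight α f).trans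
        (eq_eqToHom_rfl_conj (fiberModelMap₂ α ▷ fiberModelMap f) _ _) }

end

/-! ### Gluing functors along the fibres over a discrete category -/

section

variable {C C' D : Cat.{v, u}}

/-- The inclusion of a strict fibre. -/
def fiberIncl (φ : C ⟶ D) (x : D) : fiberCat φ x ⟶ C :=
  Cat.Hom.ofFunctor
    { obj := fun p => Fiber.pt p
      map := fun f => f
      map_id := fun _ => rfl
      map_comp := fun _ _ => rfl }

/-- An object of the domain as an object of the fibre over its image. -/
def Fiber.self (φ : C ⟶ D) (p : C) : Fiber φ (φ.toFunctor.obj p) :=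
  ⟨p, rfl⟩

variable {φ : C ⟶ D} {φ' : C' ⟶ D} (Θ : ∀ x : D, fiberCat φ x ⟶ fiberCat φ' x)

/-- The action on objects of the functor glued from functors on fibres. -/
def glueObj (p : C) : C' :=
  Fiber.pt ((Θ (φ.toFunctor.obj p)).toFunctor.obj (Fiber.self φ p))

theorem glueObj_eq {x : D} (p : Fiber φ x) :
    glueObj Θ p.pt = Fiber.pt ((Θ x).toFunctor.obj p) := by
  obtain ⟨p, rfl⟩ := p
  rfl

theorem map_glueObj (p : C) : φ'.toFunctor.obj (glueObj Θ p) = φ.toFunctor.obj p :=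
  Fiber.mem ((Θ (φ.toFunctor.obj p)).toFunctor.obj (Fiber.self φ p))

variable [hD : IsDiscrete D]

theorem Fiber.obj_eq_of_hom (φ : C ⟶ D) {p q : C} (f : p ⟶ q) :
    φ.toFunctor.obj q = φ.toFunctor.obj p :=
  (obj_ext_of_isDiscrete (φ.toFunctor.map f)).symm

/-- The action on morphisms of the functor glued from functors on fibres. -/
def glueMap {p q : C} (f : p ⟶ q) : glueObj Θ p ⟶ glueObj Θ q :=
  (fiberIncl φ' _).toFunctor.map ((Θ (φ.toFunctor.obj p)).toFunctor.map
    (show Fiber.self φ p ⟶ ⟨q, Fiber.obj_eq_of_hom φ f⟩ from f)) ≫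
      eqToHom (glueObj_eq Θ ⟨q, Fiber.obj_eq_of_hom φ f⟩).symm

theorem glueMap_heq {x : D} {p q : Fiber φ x} (f : p ⟶ q) :
    glueMap Θ (p := p.pt) (q := q.pt) f ≍
      (fiberIncl φ' _).toFunctor.map ((Θ x).toFunctor.map f) := by
  obtain ⟨p, rfl⟩ := p
  exact comp_eqToHom_heq _ _

/-- The functor glued from functors on the fibres over a discrete category. -/
def glue : C ⟶ C' :=
  Cat.Hom.ofFunctor
    { obj := glueObj Θ
      map := fun f => glueMap Θ f
      map_id := fun p => eq_of_heq ((glueMap_heq Θ (𝟙 (Fiber.self φ p))).trans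
        (heq_of_eq ((Θ _).toFunctor.map_id (Fiber.self φ p))))
      map_comp := fun {p q r} f g => by
        have hq := Fiber.obj_eq_of_hom φ f
        have hr := (Fiber.obj_eq_of_hom φ g).trans hq
        let q' : Fiber φ (φ.toFunctor.obj p) := ⟨q, hq⟩
        let r' : Fiber φ (φ.toFunctor.obj p) := ⟨r, hr⟩
        let f' : Fiber.self φ p ⟶ q' := f
        let g' : q' ⟶ r' := g
        refine eq_of_heq ((glueMap_heq Θ (f' ≫ g')).trans
          ((heq_of_eq ((Θ _).toFunctor.map_comp f' g')).trans ?_))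
        exact heq_comp rfl (glueObj_eq Θ q').symm (glueObj_eq Θ r').symm
          (glueMap_heq Θ f').symm (glueMap_heq Θ g').symm }

theorem cat_hom₂_subsingleton {F G : C ⟶ D} (α β : F ⟶ G) : α = β :=
  cat_hom₂_ext fun _ => Subsingleton.elim _ _

end

section

variable {A : Type u₁} [Bicategory.{w₁, v₁} A] [Strict A] {𝒜 : FCategory A}
  {B : Type u₂} [Bicategory.{w₂, v₂} B] [Strict B] {ℬ : FCategory B} {P Q : PseudoFFunctor 𝒜 ℬ}

theorem naturality_map₂_id {a b : A} {f : a ⟶ b} {s : P.obj a ⟶ Q.obj a}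
    {t : P.obj b ⟶ Q.obj b} (n : s ≫ Q.map f ⟶ P.map f ≫ t) :
    n ≫ P.map₂ (𝟙 f) ▷ t = s ◁ Q.map₂ (𝟙 f) ≫ n := by
  rw [P.map₂_id, Q.map₂_id]
  simp

theorem naturality_id_of_eqToHom {a : A} {s : P.obj a ⟶ Q.obj a}
    (h : s ≫ Q.map (𝟙 a) = P.map (𝟙 a) ≫ s) :
    s ◁ (Q.mapId a).inv ≫ eqToHom h =
      (ρ_ s).hom ≫ (λ_ s).inv ≫ (P.mapId a).inv ▷ s := by
  rw [P.mapId_eq_eqToIso, Q.mapId_eq_eqToIso]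
  simp [Strict.leftUnitor_eqToIso, Strict.rightUnitor_eqToIso]

end

section

variable {A : Type u} [Bicategory.{w, v} A] [Strict A] {𝒜 : FCategory A}
  {P Q M : PseudoFFunctor 𝒜 (chordate Cat.{v₁, u₁})} [∀ a, IsDiscrete (M.obj a)]
  {φ : LaxFTrans P M} {ψ : LaxFTrans Q M} (θ : LaxFTrans (fiberFunctor φ) (fiberFunctor ψ))

/-- The functor glued from the components of a lax transformation between functors of fibres. -/
def glueApp (a : A) : P.obj a ⟶ Q.obj a :=
  glue (D := M.obj a) (φ := φ.app a) (φ' := ψ.app a) (fun x => θ.app ⟨a, x⟩)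

theorem glueApp_obj {Z : El M.toPseudofunctor} (p : fiberCat (φ.app Z.base) Z.elt) :
    (glueApp θ Z.base).toFunctor.obj (Fiber.pt p) = Fiber.pt ((θ.app Z).toFunctor.obj p) :=
  glueObj_eq (D := M.obj Z.base) (φ := φ.app Z.base) (φ' := ψ.app Z.base)
    (fun x => θ.app ⟨Z.base, x⟩) p

theorem glueApp_map_heq {Z : El M.toPseudofunctor} {p q : fiberCat (φ.app Z.base) Z.elt}
    (f : p ⟶ q) :
    (glueApp θ Z.base).toFunctor.map ((fiberIncl (φ.app Z.base) Z.elt).toFunctor.map f) ≍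
      (fiberIncl (ψ.app Z.base) Z.elt).toFunctor.map ((θ.app Z).toFunctor.map f) :=
  glueMap_heq (D := M.obj Z.base) (φ := φ.app Z.base) (φ' := ψ.app Z.base)
    (fun x => θ.app ⟨Z.base, x⟩) f

/-- The 1-cell of the 2-category of elements over `f` with domain `(a, x)`. -/
def El.arrow (M : PseudoFFunctor 𝒜 (chordate Cat.{v₁, u₁})) [∀ a, IsDiscrete (M.obj a)] {a b : A}
    (f : a ⟶ b) (x : M.obj a) :
    (⟨a, x⟩ : El M.toPseudofunctor) ⟶ ⟨b, (M.map f).toFunctor.obj x⟩ :=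
  El.Hom.mk f rfl

/-- The naturality 2-cells of the lax transformation glued from a lax transformation between
functors of fibres. -/
def glueNaturality {a b : A} (f : a ⟶ b) (p : P.obj a) :
    (Q.map f).toFunctor.obj ((glueApp θ a).toFunctor.obj p) ⟶
      (glueApp θ b).toFunctor.obj ((P.map f).toFunctor.obj p) :=
  (fiberIncl (ψ.app b) _).toFunctor.map
    ((θ.naturality (El.arrow M f ((φ.app a).toFunctor.obj p))).toNatTrans.app
      (Fiber.self (φ.app a) p)) ≫
    eqToHom (glueApp_obj θ (Z := ⟨b, (M.map f).toFunctor.obj ((φ.app a).toFunctor.obj p)⟩)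
      (Fiber.mk ((P.map f).toFunctor.obj p) (φ.map_app_obj f p))).symm

/-- The glued naturality 2-cell at an object of a fibre may be computed with any 1-cell of the
2-category of elements over the given one, not only with the chosen `El.arrow`. -/
theorem glueNaturality_heq {Y Z : El M.toPseudofunctor} (f : Y ⟶ Z)
    (p : fiberCat (φ.app Y.base) Y.elt) :
    glueNaturality θ f.base (Fiber.pt p) ≍
      (fiberIncl (ψ.app Z.base) Z.elt).toFunctor.map ((θ.naturality f).toNatTrans.app p) := by
  obtain ⟨b, y⟩ := Z
  obtain ⟨a, x⟩ := Y
  obtain ⟨f, h⟩ := f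
  obtain ⟨p, h'⟩ := p
  change a ⟶ b at f
  change P.obj a at p
  change (φ.app a).toFunctor.obj p = x at h'
  change (M.map f).toFunctor.obj x = y at h
  subst h'
  subst h
  exact comp_eqToHom_heq _ _

theorem glueNaturality_naturality {a b : A} (f : a ⟶ b) {p q : P.obj a} (m : p ⟶ q) :
    (Q.map f).toFunctor.map ((glueApp θ a).toFunctor.map m) ≫ glueNaturality θ f q =
      glueNaturality θ f p ≫ (glueApp θ b).toFunctor.map ((P.map f).toFunctor.map m) := by
  -- Both `p` and `q` lie in the fibre over the image of `p`.
  let x : M.obj a := (φ.app a).toFunctor.obj p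
  let F := El.arrow M f x
  let p' : fiberCat (φ.app a) x := Fiber.self (φ.app a) p
  let q' : fiberCat (φ.app a) x :=
    Fiber.mk q (Fiber.obj_eq_of_hom (D := M.obj a) (φ.app a) m)
  let m' : p' ⟶ q' := m
  have hp := glueApp_obj θ (Z := ⟨a, x⟩) p'
  have hq := glueApp_obj θ (Z := ⟨a, x⟩) q'
  have hFp := glueApp_obj θ (((fiberFunctor φ).map F).toFunctor.obj p')
  have hFq := glueApp_obj θ (((fiberFunctor φ).map F).toFunctor.obj q')
  have n := (θ.naturality F).toNatTrans.naturality m'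
  refine eq_of_heq ((heq_comp (congrArg (Q.map f).toFunctor.obj hp)
    (congrArg (Q.map f).toFunctor.obj hq) hFq
    (functor_map_heq (Q.map f).toFunctor hp hq (glueApp_map_heq θ (Z := ⟨a, x⟩) m'))
    (glueNaturality_heq θ F q')).trans ((heq_of_eq n).trans ?_))
  exact heq_comp (congrArg (Q.map f).toFunctor.obj hp).symm hFp.symm hFq.symm
    (glueNaturality_heq θ F p').symm
    (glueApp_map_heq θ (((fiberFunctor φ).map F).toFunctor.map m')).symm

/-- The naturality 2-cells of the glued lax transformation, as natural transformations. -/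
def glueNaturality₂ {a b : A} (f : a ⟶ b) :
    glueApp θ a ≫ Q.map f ⟶ P.map f ≫ glueApp θ b :=
  Cat.Hom₂.ofNatTrans
    { app := fun p => glueNaturality θ f p
      naturality := fun _ _ m => glueNaturality_naturality θ f m }

theorem glueNaturality₂_of_inert {a b : A} (f : a ⟶ b) (hf : 𝒜.Inert f) :
    ∃ h : glueApp θ a ≫ Q.map f = P.map f ≫ glueApp θ b,
      glueNaturality₂ θ f = eqToHom h := by
  refine cat_hom₂_eq_eqToHom _ fun p => ?_
  let F := El.arrow M f ((φ.app a).toFunctor.obj p)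
  let p' : fiberCat (φ.app a) ((φ.app a).toFunctor.obj p) := Fiber.self (φ.app a) p
  obtain ⟨h, e⟩ := θ.naturality_of_inert F hf
  have hFp := glueApp_obj θ (((fiberFunctor φ).map F).toFunctor.obj p')
  refine ⟨(congrArg Fiber.pt (cat_hom_obj_congr h p')).trans hFp.symm, ?_⟩
  refine eq_eqToHom_of_heq_id _ ((glueNaturality_heq θ F p').trans
    ((heq_of_eq (congrArg (fun β => β.toNatTrans.app p') e)).trans
      (cat_eqToHom_app_heq h p'))) rfl

theorem glueNaturality_comp {a b c : A} (f : a ⟶ b) (g : b ⟶ c) (p : P.obj a) :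
    (Q.mapComp f g).inv.toNatTrans.app ((glueApp θ a).toFunctor.obj p) ≫
        glueNaturality θ (f ≫ g) p =
      ((Q.map g).toFunctor.map (glueNaturality θ f p) ≫
        glueNaturality θ g ((P.map f).toFunctor.obj p)) ≫
          (glueApp θ c).toFunctor.map ((P.mapComp f g).inv.toNatTrans.app p) := by
  let F := El.arrow M f ((φ.app a).toFunctor.obj p)
  let G := El.arrow M g ((M.map f).toFunctor.obj ((φ.app a).toFunctor.obj p))
  let p' : fiberCat (φ.app a) ((φ.app a).toFunctor.obj p) := Fiber.self (φ.app a) p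
  have hF := glueApp_obj θ (((fiberFunctor φ).map F).toFunctor.obj p')
  have hG := glueApp_obj θ (((fiberFunctor φ).map G).toFunctor.obj
    (((fiberFunctor φ).map F).toFunctor.obj p'))
  have hFG := glueApp_obj θ (((fiberFunctor φ).map (F ≫ G)).toFunctor.obj p')
  have n := (congrArg (fun β => β.toNatTrans.app p') (θ.naturality_comp F G)).trans
    ((Category.id_comp _).trans (congrArg (CategoryStruct.comp _)
      ((Category.id_comp _).trans (congrArg (CategoryStruct.comp _) (Category.id_comp _)))))
  refine eq_of_heq ((heq_comp rfl rfl hFG HEq.rfl (glueNaturality_heq θ (F ≫ G) p')).trans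
    ((heq_of_eq (n.trans (Category.assoc _ _ _).symm)).trans ?_))
  refine heq_comp rfl hG.symm hFG.symm (heq_comp rfl
    (congrArg (Q.map g).toFunctor.obj hF.symm) hG.symm
    (functor_map_heq (Q.map g).toFunctor rfl hF.symm (glueNaturality_heq θ F p').symm)
    (glueNaturality_heq θ G _).symm) ?_
  exact (glueApp_map_heq θ (((fiberFunctor φ).mapComp F G).inv.toNatTrans.app p')).symm

variable [IsLocallyDiscrete A]

/-- The lax-`ℱ`-transformation glued from a lax-`ℱ`-transformation between functors of fibres. -/
def glueTrans : LaxFTrans P Q where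
  app := glueApp θ
  naturality f := glueNaturality₂ θ f
  naturality_naturality {a b f g} α := by
    obtain rfl := obj_ext_of_isDiscrete α
    obtain rfl := Subsingleton.elim α (𝟙 f)
    exact naturality_map₂_id (glueNaturality₂ θ f)
  naturality_id a := by
    obtain ⟨h, e⟩ := glueNaturality₂_of_inert θ (𝟙 a) (𝒜.inert_id a)
    exact (congrArg (CategoryStruct.comp _) e).trans (naturality_id_of_eqToHom h)
  naturality_comp {a b c} f g := cat_hom₂_ext fun p => (glueNaturality_comp θ f g p).trans (by
    refine Eq.trans ?_ ((Category.id_comp _).trans (congrArg (CategoryStruct.comp _)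
      ((Category.id_comp _).trans (congrArg (CategoryStruct.comp _) (Category.id_comp _))))).symm
    exact Category.assoc _ _ _)
  naturality_of_inert f hf := glueNaturality₂_of_inert θ f hf

end

/-! ### The 2-functor of fibres is a local isomorphism -/

theorem hom_heq_of_isDiscrete {D : Type u} [Category.{v} D] [IsDiscrete D] {x y x' y' : D}
    (hx : x = x') (hy : y = y') (f : x ⟶ y) (g : x' ⟶ y') : f ≍ g := by
  subst hx hy
  exact heq_of_eq (Subsingleton.elim _ _)

theorem cat_hom₂_hext {C D : Cat.{v, u}} {F G F' G' : C ⟶ D} (hF : F = F') (hG : G = G')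
    {α : F ⟶ G} {β : F' ⟶ G'} (h : ∀ x, α.toNatTrans.app x ≍ β.toNatTrans.app x) : α ≍ β := by
  subst hF hG
  exact heq_of_eq (cat_hom₂_ext fun x => eq_of_heq (h x))

section

variable {A : Type u} [Bicategory.{w, v} A] [Strict A] {𝒜 : FSketch.{wJ, vJ, uJ} A}
  {M : PsModLx 𝒜 (limitSketch.{wJ, vJ, uJ} Cat.{v₁, u₁})} [∀ a, IsDiscrete (M.obj a)]

theorem hom₂_subsingleton_of_isDiscrete {P : PsModLx 𝒜 (limitSketch.{wJ, vJ, uJ} Cat.{v₁, u₁})}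
    {η θ : P ⟶ M} (Γ Γ' : η ⟶ θ) : Γ = Γ' :=
  PsModLx.hom₂_ext fun a => cat_hom₂_subsingleton (D := M.obj a) _ _

/-- Lax-`ℱ`-transformations with discrete codomain are determined by their components on
objects. -/
theorem hom_ext_of_isDiscrete {P : PsModLx 𝒜 (limitSketch.{wJ, vJ, uJ} Cat.{v₁, u₁})}
    {η θ : P ⟶ M}
    (h : ∀ a (p : P.obj a), (η.app a).toFunctor.obj p = (θ.app a).toFunctor.obj p) : η = θ := by
  have e : ∀ a, η.app a = θ.app a := fun a => cat_hom_hext (h a) fun p q f =>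
    hom_heq_of_isDiscrete (D := M.obj a) (h a p) (h a q) _ _
  let Γ : η ⟶ θ := PsModLx.Hom₂.mk (η := η) (θ := θ)
    { app := fun a => eqToHom (e a)
      naturality := fun {a b} f => cat_hom₂_subsingleton (D := M.obj b) _ _ }
  exact PsModLx.eq_of_hom₂ Γ fun a => ⟨e a, rfl⟩

theorem fiberModelMap₂_injective {X Y : Slice M} {f g : X ⟶ Y} {α β : f ⟶ g}
    (h : fiberModelMap₂ α = fiberModelMap₂ β) : α = β := by
  refine Slice.Hom₂.ext (PsModLx.hom₂_ext fun a => cat_hom₂_ext fun p => ?_)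
  let Z : El M.toPseudofunctor := ⟨a, (X.hom.app a).toFunctor.obj p⟩
  exact congrArg (fun Γ : fiberModelMap f ⟶ fiberModelMap g =>
    (Γ.as.app Z).toNatTrans.app (Fiber.self (X.hom.app a) p)) h

/-- The components of the 2-cell glued from a 2-cell between pseudo-models of fibres. -/
def glueModApp {X Y : Slice M} {f g : X ⟶ Y} (Γ : fiberModelMap f ⟶ fiberModelMap g) (a : A)
    (p : X.obj.obj a) :
    (f.left.app a).toFunctor.obj p ⟶ (g.left.app a).toFunctor.obj p :=
  (fiberIncl (Y.hom.app a) _).toFunctor.map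
    ((Γ.as.app ⟨a, (X.hom.app a).toFunctor.obj p⟩).toNatTrans.app (Fiber.self (X.hom.app a) p))

theorem glueModApp_eq {X Y : Slice M} {f g : X ⟶ Y} (Γ : fiberModelMap f ⟶ fiberModelMap g)
    {Z : El M.toPseudofunctor} (p : fiberCat (X.hom.app Z.base) Z.elt) :
    glueModApp Γ Z.base (Fiber.pt p) =
      (fiberIncl (Y.hom.app Z.base) _).toFunctor.map ((Γ.as.app Z).toNatTrans.app p) := by
  obtain ⟨a, x⟩ := Z
  obtain ⟨p, h⟩ := p
  change X.obj.obj a at p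
  change (X.hom.app a).toFunctor.obj p = x at h
  subst h
  rfl

/-- The 2-cell glued from a 2-cell between pseudo-models of fibres. -/
def glueMod {X Y : Slice M} {f g : X ⟶ Y} (Γ : fiberModelMap f ⟶ fiberModelMap g) : f ⟶ g :=
  Slice.Hom₂.mk (f := f) (g := g)
    (PsModLx.Hom₂.mk (η := f.left) (θ := g.left)
      { app := fun a => Cat.Hom₂.ofNatTrans
          { app := fun p => glueModApp Γ a p
            naturality := fun p q m => by
              let Z : El M.toPseudofunctor := ⟨a, (X.hom.app a).toFunctor.obj p⟩
              let p' : fiberCat (X.hom.app a) Z.elt := Fiber.self (X.hom.app a) p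
              let q' : fiberCat (X.hom.app a) Z.elt :=
                Fiber.mk q (Fiber.obj_eq_of_hom (D := M.obj a) (X.hom.app a) m)
              let m' : p' ⟶ q' := m
              exact (congrArg (CategoryStruct.comp _) (glueModApp_eq Γ (Z := Z) q')).trans
                ((Γ.as.app Z).toNatTrans.naturality m') }
        naturality := fun {a b} u => cat_hom₂_ext fun p => by
          let x : M.obj a := (X.hom.app a).toFunctor.obj p
          let F := El.arrow M.toPseudoFFunctor u x
          let p' : fiberCat (X.hom.app a) x := Fiber.self (X.hom.app a) p
          have n := congrArg (fun β => β.toNatTrans.app p') (Γ.as.naturality F)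
          exact n.trans (congrArg (CategoryStruct.comp _) (glueModApp_eq Γ
            (((fiberFunctor X.hom).map F).toFunctor.obj p')).symm) })
    (hom₂_subsingleton_of_isDiscrete _ _)

theorem fiberModelMap₂_glueMod {X Y : Slice M} {f g : X ⟶ Y}
    (Γ : fiberModelMap f ⟶ fiberModelMap g) : fiberModelMap₂ (glueMod Γ) = Γ :=
  PsModLx.hom₂_ext fun Z => cat_hom₂_ext fun p => glueModApp_eq Γ (Z := Z) p

theorem fiberModelMap_injective {X Y : Slice M} {f g : X ⟶ Y}
    (h : fiberModelMap f = fiberModelMap g) : f = g := by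
  refine Slice.Hom.ext (PsModLx.eq_of_hom₂ (glueMod (eqToHom h)).left fun a =>
    cat_hom₂_eq_eqToHom _ fun p => ?_)
  let Z : El M.toPseudofunctor := ⟨a, (X.hom.app a).toFunctor.obj p⟩
  let p' : fiberCat (X.hom.app a) Z.elt := Fiber.self (X.hom.app a) p
  have e := congrArg (fun τ : fiberModel X ⟶ fiberModel Y => τ.app Z) h
  refine ⟨congrArg Fiber.pt (cat_hom_obj_congr e p'), ?_⟩
  refine eq_eqToHom_of_heq_id _ (HEq.trans (heq_of_eq ?_) (cat_eqToHom_app_heq e p')) rfl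
  exact congrArg (fun β => β.toNatTrans.app p') (PsModLx.eqToHom_as_app h Z)

end

section

variable {A : Type u} [Bicategory.{w, v} A] [IsLocallyDiscrete A] {𝒜 : FSketch.{wJ, vJ, uJ} A}
  {M : PsModLx 𝒜 (limitSketch.{wJ, vJ, uJ} Cat.{v₁, u₁})} [∀ a, IsDiscrete (M.obj a)]

/-- The 1-cell of the slice glued from a 1-cell between pseudo-models of fibres. -/
def glueHom {X Y : Slice M} (θ : fiberModel X ⟶ fiberModel Y) : X ⟶ Y :=
  Slice.Hom.mk (X := X) (Y := Y) (glueTrans (φ := X.hom) (ψ := Y.hom) θ)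
    (hom_ext_of_isDiscrete fun a _ => map_glueObj (D := M.obj a) (φ := X.hom.app a)
      (φ' := Y.hom.app a) (fun x => θ.app ⟨a, x⟩) _)

theorem fiberModelMap_glueHom {X Y : Slice M} (θ : fiberModel X ⟶ fiberModel Y) :
    fiberModelMap (glueHom θ) = θ := by
  have e : ∀ Z, (fiberModelMap (glueHom θ)).app Z = θ.app Z := fun Z =>
    cat_hom_hext (fun p => Fiber.ext (glueApp_obj (φ := X.hom) (ψ := Y.hom) θ (Z := Z) p))
      (fun p q f => glueApp_map_heq (φ := X.hom) (ψ := Y.hom) θ (Z := Z) f)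
  let Γ : fiberModelMap (glueHom θ) ⟶ θ := PsModLx.Hom₂.mk (η := fiberModelMap (glueHom θ))
    (θ := θ)
    { app := fun Z => eqToHom (e Z)
      naturality := fun {Z W} f => by
        rw [eqToHom_whiskerRight, whiskerLeft_eqToHom]
        refine eq_of_heq ((eqToHom_comp_heq _ _).trans
          (HEq.trans ?_ (comp_eqToHom_heq _ _).symm))
        refine cat_hom₂_hext (congrArg (· ≫ (fiberFunctor Y.hom).map f) (e Z)).symm
          (congrArg ((fiberFunctor X.hom).map f ≫ ·) (e W)).symm fun p => ?_
        exact (glueNaturality_heq (φ := X.hom) (ψ := Y.hom) θ f p).symm }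
  exact PsModLx.eq_of_hom₂ Γ fun Z => ⟨e Z, rfl⟩

theorem isLocalIso_fiberTwoFunctor : IsLocalIso (fiberTwoFunctor M) where
  map_bijective _ _ := ⟨fun _ _ h => fiberModelMap_injective h,
    fun θ => ⟨glueHom θ, fiberModelMap_glueHom θ⟩⟩
  map₂_bijective _ _ := ⟨fun _ _ h => fiberModelMap₂_injective h,
    fun Γ => ⟨glueMod Γ, fiberModelMap₂_glueMod Γ⟩⟩

end

/-! ### Disjoint unions of categories -/

section

/-- An object of the disjoint union of a family of categories. -/
structure Total {I : Type u} (C : I → Cat.{v, u}) where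
  /-- The index. -/
  base : I
  /-- The object of the category with that index. -/
  pt : C base

variable {I : Type u} {C : I → Cat.{v, u}}

/-- A morphism of the disjoint union: an equality of indices together with a morphism out of the
transported object.  Since the equality is a proposition, the morphisms stay in the universe of
the morphisms of the summands. -/
structure Total.Hom (X Y : Total C) : Type v where
  base : X.base = Y.base
  /-- The underlying morphism. -/
  hom : (base ▸ X.pt : C Y.base) ⟶ Y.pt

/-- Composition in the disjoint union, with the indices made explicit. -/
def Total.compAux {i j k : I} {c : C i} {d : C j} {e : C k} (h : i = j) (h' : j = k)
    (f : (h ▸ c : C j) ⟶ d) (g : (h' ▸ d : C k) ⟶ e) : (h.trans h' ▸ c : C k) ⟶ e := by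
  subst h h'
  exact f ≫ g

instance : Category.{v} (Total C) where
  Hom := Total.Hom
  id X := ⟨rfl, 𝟙 X.pt⟩
  comp f g := ⟨f.base.trans g.base, Total.compAux f.base g.base f.hom g.hom⟩
  id_comp := by
    rintro ⟨i, c⟩ ⟨j, d⟩ ⟨h, f⟩
    dsimp only at h
    subst h
    exact congrArg (Total.Hom.mk (X := ⟨i, c⟩) (Y := ⟨i, d⟩) rfl) (Category.id_comp f)
  comp_id := by
    rintro ⟨i, c⟩ ⟨j, d⟩ ⟨h, f⟩
    dsimp only at h
    subst h
    exact congrArg (Total.Hom.mk (X := ⟨i, c⟩) (Y := ⟨i, d⟩) rfl) (Category.comp_id f)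
  assoc := by
    rintro ⟨i, c⟩ ⟨j, d⟩ ⟨k, d'⟩ ⟨l, d''⟩ ⟨h, f⟩ ⟨h', f'⟩ ⟨h'', f''⟩
    dsimp only at h h' h''
    subst h h' h''
    exact congrArg (Total.Hom.mk (X := ⟨i, c⟩) (Y := ⟨i, d''⟩) rfl) (Category.assoc f f' f'')

variable (C) in
/-- The disjoint union as an object of the 2-category of categories. -/
def totalCat : Cat.{v, u} :=
  Cat.of (Total C)

variable (C) in
/-- The inclusion of a summand. -/
def totalIncl (i : I) : C i ⟶ totalCat C :=
  Cat.Hom.ofFunctor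
    { obj := fun c => Total.mk i c
      map := fun f => Total.Hom.mk rfl f
      map_id := fun _ => rfl
      map_comp := fun _ _ => rfl }

theorem Total.hom_cases {motive : ∀ {X Y : totalCat C}, (X ⟶ Y) → Prop}
    (h : ∀ (i : I) {c d : C i} (f : c ⟶ d), motive ((totalIncl C i).toFunctor.map f))
    {X Y : totalCat C} (f : X ⟶ Y) : motive f := by
  obtain ⟨i, c⟩ := X
  obtain ⟨j, d⟩ := Y
  obtain ⟨e, f⟩ := f
  dsimp only at e
  subst e
  exact h i f

theorem totalIncl_obj_injective {i : I} {c d : C i}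
    (h : (totalIncl C i).toFunctor.obj c = (totalIncl C i).toFunctor.obj d) : c = d := by
  change Total.mk i c = Total.mk i d at h
  injection h

theorem totalIncl_map_injective {i : I} {c d : C i} {f g : c ⟶ d}
    (h : (totalIncl C i).toFunctor.map f = (totalIncl C i).toFunctor.map g) : f = g := by
  change Total.Hom.mk (X := ⟨i, c⟩) (Y := ⟨i, d⟩) rfl f =
    Total.Hom.mk (X := ⟨i, c⟩) (Y := ⟨i, d⟩) rfl g at h
  injection h

theorem totalIncl_map_heq_injective {i : I} {c d c' d' : C i} {f : c ⟶ d} {g : c' ⟶ d'}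
    (hc : c = c') (hd : d = d')
    (h : (totalIncl C i).toFunctor.map f ≍ (totalIncl C i).toFunctor.map g) : f ≍ g := by
  subst hc hd
  exact heq_of_eq (totalIncl_map_injective (eq_of_heq h))

theorem totalIncl_map_surjective {i : I} {c d : C i}
    (f : (totalIncl C i).toFunctor.obj c ⟶ (totalIncl C i).toFunctor.obj d) :
    ∃ g : c ⟶ d, (totalIncl C i).toFunctor.map g = f := by
  obtain ⟨_, f⟩ := f
  exact ⟨f, rfl⟩

variable {D : Cat.{v, u}}

/-- The action on morphisms of the functor out of a disjoint union. -/
def totalDescMap (F : ∀ i, C i ⟶ D) {i j : I} {c : C i} {d : C j} (h : i = j)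
    (f : (h ▸ c : C j) ⟶ d) : (F i).toFunctor.obj c ⟶ (F j).toFunctor.obj d := by
  subst h
  exact (F i).toFunctor.map f

/-- The functor out of a disjoint union given by functors out of the summands. -/
def totalDesc (F : ∀ i, C i ⟶ D) : totalCat C ⟶ D :=
  Cat.Hom.ofFunctor
    { obj := fun X => (F (Total.base X)).toFunctor.obj (Total.pt X)
      map := fun f => totalDescMap F (Total.Hom.base f) (Total.Hom.hom f)
      map_id := fun X => (F (Total.base X)).toFunctor.map_id (Total.pt X)
      map_comp := by
        rintro ⟨i, c⟩ ⟨j, d⟩ ⟨k, e⟩ ⟨h, f⟩ ⟨h', g⟩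
        dsimp only at h h'
        subst h h'
        exact (F i).toFunctor.map_comp f g }

/-- A natural transformation between functors out of a disjoint union is given by components that
are natural on every summand. -/
def totalHom₂ {F G : totalCat C ⟶ D} (α : ∀ X, F.toFunctor.obj X ⟶ G.toFunctor.obj X)
    (h : ∀ (i : I) {c d : C i} (f : c ⟶ d),
      F.toFunctor.map ((totalIncl C i).toFunctor.map f) ≫ α _ =
        α _ ≫ G.toFunctor.map ((totalIncl C i).toFunctor.map f)) : F ⟶ G :=
  Cat.Hom₂.ofNatTrans
    { app := α
      naturality := fun _ _ f => Total.hom_cases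
        (motive := fun {X Y} f => F.toFunctor.map f ≫ α Y = α X ≫ G.toFunctor.map f)
        (fun i _ _ f => h i f) f }

end

/-! ### The total functor of a functor on the 2-category of elements -/

theorem comp_inv_eq_inv_comp {C : Type u} [Category.{v} C] {x y x' y' : C} {f : x ⟶ y}
    {f' : x' ⟶ y'} {i : x ⟶ x'} {j : y ⟶ y'} {i' : x' ⟶ x} {j' : y' ⟶ y} (hi : i' ≫ i = 𝟙 x')
    (hj : j ≫ j' = 𝟙 y) (h : f ≫ j = i ≫ f') : f' ≫ j' = i' ≫ f := by
  rw [← Category.id_comp f', ← hi, Category.assoc i', ← h, Category.assoc, Category.assoc, hj,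
    Category.comp_id]

section

variable {A : Type u} [Bicategory.{w, v} A] [IsLocallyDiscrete A]

/-- A pseudofunctor on a locally discrete 2-category maps 2-cells to identities. -/
theorem map₂_app_heq_id (F : Pseudofunctor A Cat.{v₁, u₁}) {a b : A} {f g : a ⟶ b} (α : f ⟶ g)
    (p : F.obj a) : (F.map₂ α).toNatTrans.app p ≍ 𝟙 ((F.map f).toFunctor.obj p) := by
  obtain rfl := obj_ext_of_isDiscrete α
  obtain rfl := Subsingleton.elim α (𝟙 f)
  rw [F.map₂_id]
  rfl

instance (M : Pseudofunctor A Cat.{v₁, u₁}) [∀ a, IsDiscrete (M.obj a)] :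
    IsLocallyDiscrete (El M) := fun _ _ =>
  { subsingleton := fun _ _ => ⟨fun _ _ => El.Hom₂.ext (Subsingleton.elim _ _)⟩
    eq_of_hom := fun α => El.Hom.ext (obj_ext_of_isDiscrete α.base) }

variable {𝒜 : FCategory A} {M : PseudoFFunctor 𝒜 (chordate Cat.{v₁, u₁})}
  [∀ a, IsDiscrete (M.obj a)]
  (N : PseudoFFunctor (El.fCategory M.toPseudofunctor 𝒜) (chordate Cat.{v₁, u₁}))

/-- The disjoint union of the categories `N (a, x)` over the elements `x` of `M a`. -/
def totalObj (a : A) : Cat.{v₁, u₁} :=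
  totalCat (fun x : M.obj a => N.obj ⟨a, x⟩)

/-- The inclusion of `N (a, x)` into the disjoint union. -/
def elIncl (Y : El M.toPseudofunctor) : N.obj Y ⟶ totalObj N Y.base :=
  totalIncl (fun x : M.obj Y.base => N.obj ⟨Y.base, x⟩) Y.elt

/-- The functor between disjoint unions induced by a 1-cell. -/
def totalMap {a b : A} (f : a ⟶ b) : totalObj N a ⟶ totalObj N b :=
  totalDesc (fun x : M.obj a =>
    N.map (El.arrow M f x) ≫ elIncl N ⟨b, (M.map f).toFunctor.obj x⟩)

theorem elIncl_comp {Y Z : El M.toPseudofunctor} (F : Y ⟶ Z) :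
    elIncl N Y ≫ totalMap N F.base = N.map F ≫ elIncl N Z := by
  obtain ⟨a, x⟩ := Y
  obtain ⟨b, y⟩ := Z
  obtain ⟨f, h⟩ := F
  change a ⟶ b at f
  change (M.map f).toFunctor.obj x = y at h
  subst h
  rfl

theorem totalMap_obj {Y Z : El M.toPseudofunctor} (F : Y ⟶ Z) (m : N.obj Y) :
    (totalMap N F.base).toFunctor.obj ((elIncl N Y).toFunctor.obj m) =
      (elIncl N Z).toFunctor.obj ((N.map F).toFunctor.obj m) :=
  cat_hom_obj_congr (elIncl_comp N F) m

theorem totalMap_map_heq {Y Z : El M.toPseudofunctor} (F : Y ⟶ Z) {m n : N.obj Y} (k : m ⟶ n) :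
    (totalMap N F.base).toFunctor.map ((elIncl N Y).toFunctor.map k) ≍
      (elIncl N Z).toFunctor.map ((N.map F).toFunctor.map k) :=
  cat_hom_map_congr (elIncl_comp N F) k

variable {N} in
theorem totalObj_cases {a : A} {motive : totalObj N a → Prop}
    (h : ∀ (x : M.obj a) (m : N.obj ⟨a, x⟩), motive ((elIncl N ⟨a, x⟩).toFunctor.obj m))
    (X : totalObj N a) : motive X :=
  h (Total.base X) (Total.pt X)

/-- The components of the compositor of the total functor: on the summand with index `x`, these
are the components of the compositor of `N` at the 1-cells of `El(M)` over `f` and `g` that start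
at `x`. -/
def totalCompHom {a b c : A} (f : a ⟶ b) (g : b ⟶ c) (X : totalObj N a) :
    (totalMap N (f ≫ g)).toFunctor.obj X ⟶ (totalMap N f ≫ totalMap N g).toFunctor.obj X :=
  eqToHom (totalMap_obj N
    (El.arrow M f (Total.base X) ≫ El.arrow M g ((M.map f).toFunctor.obj (Total.base X)))
      (Total.pt X)) ≫
    (elIncl N _).toFunctor.map
      ((N.mapComp (El.arrow M f (Total.base X))
        (El.arrow M g ((M.map f).toFunctor.obj (Total.base X)))).hom.toNatTrans.app (Total.pt X))

/-- The inverse of `totalCompHom`. -/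
def totalCompInv {a b c : A} (f : a ⟶ b) (g : b ⟶ c) (X : totalObj N a) :
    (totalMap N f ≫ totalMap N g).toFunctor.obj X ⟶ (totalMap N (f ≫ g)).toFunctor.obj X :=
  (elIncl N _).toFunctor.map
      ((N.mapComp (El.arrow M f (Total.base X))
        (El.arrow M g ((M.map f).toFunctor.obj (Total.base X)))).inv.toNatTrans.app (Total.pt X)) ≫
  eqToHom (totalMap_obj N
    (El.arrow M f (Total.base X) ≫ El.arrow M g ((M.map f).toFunctor.obj (Total.base X)))
      (Total.pt X)).symm

theorem totalCompHom_inv {a b c : A} (f : a ⟶ b) (g : b ⟶ c) (X : totalObj N a) :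
    totalCompHom N f g X ≫ totalCompInv N f g X = 𝟙 _ := by
  have h := (CategoryTheory.Functor.map_comp (elIncl N _).toFunctor _ _).symm.trans
    ((congrArg (elIncl N _).toFunctor.map (Cat.Hom.hom_inv_id_toNatTrans_app
    (N.mapComp (El.arrow M f (Total.base X))
      (El.arrow M g ((M.map f).toFunctor.obj (Total.base X)))) (Total.pt X))).trans
        (CategoryTheory.Functor.map_id _ _))
  refine (Category.assoc _ _ _).trans ((congrArg (CategoryStruct.comp _)
    ((Category.assoc _ _ _).symm.trans ((congrArg (· ≫ eqToHom _) h).trans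
      (Category.id_comp _)))).trans ?_)
  exact eqToHom_trans _ _

theorem totalCompInv_hom {a b c : A} (f : a ⟶ b) (g : b ⟶ c) (X : totalObj N a) :
    totalCompInv N f g X ≫ totalCompHom N f g X = 𝟙 _ := by
  have h := (CategoryTheory.Functor.map_comp (elIncl N _).toFunctor _ _).symm.trans
    ((congrArg (elIncl N _).toFunctor.map (Cat.Hom.inv_hom_id_toNatTrans_app
    (N.mapComp (El.arrow M f (Total.base X))
      (El.arrow M g ((M.map f).toFunctor.obj (Total.base X)))) (Total.pt X))).trans
        (CategoryTheory.Functor.map_id _ _))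
  refine (Category.assoc _ _ _).trans ((congrArg (CategoryStruct.comp _)
    ((Category.assoc _ _ _).symm.trans ((congrArg (CategoryStruct.comp · _)
      (eqToHom_trans _ _)).trans (Category.id_comp _)))).trans ?_)
  exact h

/-- The compositor of the total functor may be computed with any composable pair of 1-cells of the
2-category of elements over the given one. -/
theorem totalCompHom_heq {Y Z W : El M.toPseudofunctor} (F : Y ⟶ Z) (G : Z ⟶ W) (m : N.obj Y) :
    totalCompHom N F.base G.base ((elIncl N Y).toFunctor.obj m) ≍
      (elIncl N W).toFunctor.map ((N.mapComp F G).hom.toNatTrans.app m) := by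
  obtain ⟨a, x⟩ := Y
  obtain ⟨b, y⟩ := Z
  obtain ⟨c, z⟩ := W
  obtain ⟨f, h⟩ := F
  obtain ⟨g, h'⟩ := G
  change a ⟶ b at f
  change b ⟶ c at g
  change (M.map f).toFunctor.obj x = y at h
  change (M.map g).toFunctor.obj y = z at h'
  subst h
  subst h'
  exact eqToHom_comp_heq _ _

theorem totalCompInv_heq {Y Z W : El M.toPseudofunctor} (F : Y ⟶ Z) (G : Z ⟶ W) (m : N.obj Y) :
    totalCompInv N F.base G.base ((elIncl N Y).toFunctor.obj m) ≍
      (elIncl N W).toFunctor.map ((N.mapComp F G).inv.toNatTrans.app m) := by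
  obtain ⟨a, x⟩ := Y
  obtain ⟨b, y⟩ := Z
  obtain ⟨c, z⟩ := W
  obtain ⟨f, h⟩ := F
  obtain ⟨g, h'⟩ := G
  change a ⟶ b at f
  change b ⟶ c at g
  change (M.map f).toFunctor.obj x = y at h
  change (M.map g).toFunctor.obj y = z at h'
  subst h
  subst h'
  exact comp_eqToHom_heq _ _

theorem totalCompHom_naturality {a b c : A} (f : a ⟶ b) (g : b ⟶ c) {x : M.obj a}
    {m n : N.obj ⟨a, x⟩} (k : m ⟶ n) :
    (totalMap N (f ≫ g)).toFunctor.map ((elIncl N ⟨a, x⟩).toFunctor.map k) ≫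
        totalCompHom N f g ((elIncl N ⟨a, x⟩).toFunctor.obj n) =
      totalCompHom N f g ((elIncl N ⟨a, x⟩).toFunctor.obj m) ≫
        (totalMap N f ≫ totalMap N g).toFunctor.map ((elIncl N ⟨a, x⟩).toFunctor.map k) := by
  let F := El.arrow M f x
  let G := El.arrow M g ((M.map f).toFunctor.obj x)
  have nat := congrArg (elIncl N _).toFunctor.map ((N.mapComp F G).hom.toNatTrans.naturality k)
  have nat' := ((CategoryTheory.Functor.map_comp _ _ _).symm.trans nat).trans
    (CategoryTheory.Functor.map_comp _ _ _)
  refine eq_of_heq ((heq_comp (totalMap_obj N (F ≫ G) m) (totalMap_obj N (F ≫ G) n) rfl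
    (totalMap_map_heq N (F ≫ G) k) (totalCompHom_heq N F G n)).trans
      ((heq_of_eq nat').trans ?_))
  exact heq_comp (totalMap_obj N (F ≫ G) m).symm rfl rfl (totalCompHom_heq N F G m).symm HEq.rfl

/-- The compositor of the total functor. -/
def totalComp {a b c : A} (f : a ⟶ b) (g : b ⟶ c) :
    totalMap N (f ≫ g) ≅ totalMap N f ≫ totalMap N g where
  hom := totalHom₂ (totalCompHom N f g) (fun _ _ _ k => totalCompHom_naturality N f g k)
  inv := totalHom₂ (totalCompInv N f g) (fun _ _ _ k => comp_inv_eq_inv_comp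
    (totalCompInv_hom N f g _) (totalCompHom_inv N f g _) (totalCompHom_naturality N f g k))
  hom_inv_id := cat_hom₂_ext fun X => totalCompHom_inv N f g X
  inv_hom_id := cat_hom₂_ext fun X => totalCompInv_hom N f g X

theorem totalComp_of_inert {a b c : A} (f : a ⟶ b) (g : b ⟶ c) (h : 𝒜.Inert f ∨ 𝒜.Inert g) :
    ∃ e : totalMap N (f ≫ g) = totalMap N f ≫ totalMap N g, totalComp N f g = eqToIso e := by
  suffices H : ∃ e : totalMap N (f ≫ g) = totalMap N f ≫ totalMap N g,
      (totalComp N f g).hom = eqToHom e by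
    obtain ⟨e, he⟩ := H
    exact ⟨e, Iso.ext he⟩
  refine cat_hom₂_eq_eqToHom _ (totalObj_cases fun x m => ?_)
  let F := El.arrow M f x
  let G := El.arrow M g ((M.map f).toFunctor.obj x)
  have e := N.map_comp_of_inert F G h
  have e' : (N.mapComp F G).hom = eqToHom e := congrArg Iso.hom (N.mapComp_of_inert F G h)
  refine ⟨(totalMap_obj N (F ≫ G) m).trans
    (congrArg (elIncl N _).toFunctor.obj (cat_hom_obj_congr e m)), ?_⟩
  refine eq_eqToHom_of_heq_id _ ((totalCompHom_heq N F G m).trans ?_)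
    (totalMap_obj N (F ≫ G) m)
  refine (functor_map_heq (elIncl N _).toFunctor rfl (cat_hom_obj_congr e m).symm
    ((heq_of_eq (congrArg (fun β => β.toNatTrans.app m) e')).trans
      (cat_eqToHom_app_heq e m))).trans (heq_of_eq (CategoryTheory.Functor.map_id _ _))

theorem totalMap_id (a : A) : totalMap N (𝟙 a) = 𝟙 (totalObj N a) := by
  refine cat_hom_hext (totalObj_cases fun x m => ?_) (fun _ _ k => Total.hom_cases
    (motive := fun {X Y} k => (totalMap N (𝟙 a)).toFunctor.map k ≍ k) (fun x m n k => ?_) k)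
  · exact (totalMap_obj N (𝟙 (⟨a, x⟩ : El M.toPseudofunctor)) m).trans
      (congrArg (elIncl N _).toFunctor.obj (cat_hom_obj_congr (N.map_id _) m))
  · exact (totalMap_map_heq N (𝟙 (⟨a, x⟩ : El M.toPseudofunctor)) k).trans
      (functor_map_heq (elIncl N _).toFunctor (cat_hom_obj_congr (N.map_id _) m)
        (cat_hom_obj_congr (N.map_id _) n) (cat_hom_map_congr (N.map_id _) k))

/-- The associativity law of the total functor, in the form in which a pseudofunctor on a locally
discrete bicategory requires it. -/
theorem totalComp_assoc {a b c d : A} (f : a ⟶ b) (g : b ⟶ c) (h : c ⟶ d) :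
    (totalComp N (f ≫ g) h).hom ≫ (totalComp N f g).hom ▷ totalMap N h ≫
        (α_ (totalMap N f) (totalMap N g) (totalMap N h)).hom ≫
          totalMap N f ◁ (totalComp N g h).inv ≫ (totalComp N f (g ≫ h)).inv =
      eqToHom (by rw [Strict.assoc]) := by
  refine cat_hom₂_ext (totalObj_cases fun x m => ?_)
  let F := El.arrow M f x
  let G := El.arrow M g ((M.map f).toFunctor.obj x)
  let H := El.arrow M h ((M.map g).toFunctor.obj ((M.map f).toFunctor.obj x))
  let ι := (elIncl N ⟨d, (M.map h).toFunctor.obj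
    ((M.map g).toFunctor.obj ((M.map f).toFunctor.obj x))⟩).toFunctor
  have e₁ := totalMap_obj N ((F ≫ G) ≫ H) m
  have e₂ := totalMap_obj N (F ≫ G) m
  have e₃ := totalMap_obj N (F ≫ G ≫ H) m
  have e := congrArg (fun K => N.map K) (Strict.assoc F G H)
  rw [Cat.eqToHom_app]
  -- The image under `ι` of the associativity law of `N`, whose left-hand side is an identity.
  have n₁ := congrArg (fun β => β.toNatTrans.app m) (N.map₂_associator F G H)
  have n₂ := n₁.trans (congrArg (CategoryStruct.comp _) (congrArg
    (CategoryStruct.comp _) (Category.id_comp _)))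
  have n₃ := functor_map_heq ι rfl (cat_hom_obj_congr e.symm m)
    ((heq_of_eq n₂).symm.trans (map₂_app_heq_id N.toPseudofunctor (α_ F G H).hom m))
  have n₄ := n₃.trans (heq_of_eq (CategoryTheory.Functor.map_id _ _))
  refine eq_eqToHom_of_heq_id _ (HEq.trans ?_ n₄) e₁
  refine HEq.trans ?_ (heq_of_eq ((CategoryTheory.Functor.map_comp ι _ _).trans (congrArg
    (CategoryStruct.comp _) ((CategoryTheory.Functor.map_comp ι _ _).trans (congrArg
    (CategoryStruct.comp _) (CategoryTheory.Functor.map_comp ι _ _)))))).symm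
  refine heq_comp e₁ (congrArg (totalMap N h).toFunctor.obj e₂) e₃
    (totalCompHom_heq N (F ≫ G) H m) (heq_comp (congrArg (totalMap N h).toFunctor.obj e₂) rfl e₃
      ((functor_map_heq (totalMap N h).toFunctor e₂ rfl (totalCompHom_heq N F G m)).trans
        (totalMap_map_heq N H _)) ?_)
  refine (heq_of_eq (Category.id_comp _)).trans (heq_comp rfl ?_ e₃
    (totalCompInv_heq N G H _) (totalCompInv_heq N F (G ≫ H) m))
  exact totalMap_obj N (G ≫ H) _

end

section

variable {A : Type u} [Bicategory.{w, v} A] [IsLocallyDiscrete A]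
  {𝒜 : FCategory A} {M : PseudoFFunctor 𝒜 (chordate Cat.{v₁, u₁})}
  [∀ a, IsDiscrete (M.obj a)]
  (N : PseudoFFunctor (El.fCategory M.toPseudofunctor 𝒜) (chordate Cat.{v₁, u₁}))

/-- The total functor of a pseudo-`ℱ`-functor `N` on the 2-category of elements: it maps `a` to
the disjoint union of the categories `N (a, x)`. -/
def totalFunctor : PseudoFFunctor 𝒜 (chordate Cat.{v₁, u₁}) where
  toPseudofunctor := pseudofunctorOfIsLocallyDiscrete (totalObj N) (fun f => totalMap N f)
    (fun a => eqToIso (totalMap_id N a)) (fun f g => totalComp N f g)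
    (fun f g h => totalComp_assoc N f g h)
    (fun {a b} f => by
      obtain ⟨e, he⟩ := totalComp_of_inert N (𝟙 a) f (Or.inl (𝒜.inert_id a))
      rw [he]
      simp [Strict.leftUnitor_eqToIso])
    (fun {a b} f => by
      obtain ⟨e, he⟩ := totalComp_of_inert N f (𝟙 b) (Or.inr (𝒜.inert_id b))
      rw [he]
      simp [Strict.rightUnitor_eqToIso])
  map_id := totalMap_id N
  mapId_eq_eqToIso _ := rfl
  map_inert _ _ := trivial
  map_comp_of_inert f g h := (totalComp_of_inert N f g h).1
  mapComp_of_inert f g h := (totalComp_of_inert N f g h).2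

/-- The functor from the disjoint union of a family indexed by the objects of a discrete category
to that category. -/
def totalProj {D : Cat.{v, u}} [IsDiscrete D] (C : D → Cat.{v, u}) : totalCat C ⟶ D :=
  Cat.Hom.ofFunctor
    { obj := fun X => Total.base X
      map := fun f => eqToHom (Total.Hom.base f)
      map_id := fun _ => Subsingleton.elim _ _
      map_comp := fun _ _ => Subsingleton.elim _ _ }

/-- A lax-`ℱ`-transformation with discrete codomain is a family of functors that commute with the
action of 1-cells on objects. -/
def LaxFTrans.ofDiscrete {P : PseudoFFunctor 𝒜 (chordate Cat.{v₁, u₁})}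
    (s : ∀ a, P.obj a ⟶ M.obj a)
    (h : ∀ {a b : A} (f : a ⟶ b) (p : P.obj a),
      (M.map f).toFunctor.obj ((s a).toFunctor.obj p) =
        (s b).toFunctor.obj ((P.map f).toFunctor.obj p)) : LaxFTrans P M where
  app := s
  naturality {_ b} f := eqToHom (cat_hom_hext (h f)
    (fun p q _ => hom_heq_of_isDiscrete (D := M.obj b) (h f p) (h f q) _ _))
  naturality_naturality {_ b _ _} _ := cat_hom₂_subsingleton (D := M.obj b) _ _
  naturality_id a := cat_hom₂_subsingleton (D := M.obj a) _ _
  naturality_comp {_ _ c} _ _ := cat_hom₂_subsingleton (D := M.obj c) _ _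
  naturality_of_inert _ _ := ⟨_, rfl⟩

/-- The projection from the total functor to `M`. -/
def totalTrans : LaxFTrans (totalFunctor N) M :=
  LaxFTrans.ofDiscrete (fun a => totalProj (D := M.obj a) (fun x => N.obj ⟨a, x⟩))
    (fun _ _ => rfl)

end

/-! ### The total functor of a pseudo-model is a pseudo-model -/

section

variable {A : Type u} [Bicategory.{w, v} A]

theorem strictPseudofunctor_ext {J : Type uJ} [Bicategory.{wJ, vJ} J]
    {F G : StrictPseudofunctor J A} (h : F.toPrelaxFunctor = G.toPrelaxFunctor) : F = G := by
  obtain ⟨⟨⟨F, i, c, _, _, _, _, _⟩, hi, hi'⟩, hc, hc'⟩ := F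
  obtain ⟨⟨⟨G, j, d, _, _, _, _, _⟩, hj, hj'⟩, hd, hd'⟩ := G
  change F = G at h
  subst h
  obtain rfl : i = j := funext fun X => (hi' X).trans (hj' X).symm
  obtain rfl : @c = @d := by
    funext X Y Z f g
    exact (hc' f g).trans (hd' f g).symm
  rfl

variable [IsLocallyDiscrete A] {𝒜 : FCategory A}
  {J : Type uJ} [Bicategory.{wJ, vJ} J] [Strict J]

theorem cone_ext {a : A} {S T : Cone 𝒜 J a}
    (h : S.diagram.toPrelaxFunctor = T.diagram.toPrelaxFunctor)
    (h' : ∀ j, S.leg j ≍ T.leg j) : S = T := by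
  obtain ⟨F, l, _, _, _, _⟩ := S
  obtain ⟨G, m, _, _, _, _⟩ := T
  obtain rfl := strictPseudofunctor_ext h
  obtain rfl : l = m := funext fun j => eq_of_heq (h' j)
  rfl

variable {M : PseudoFFunctor 𝒜 (chordate Cat.{v₁, u₁})} [∀ a, IsDiscrete (M.obj a)]

/-- The lift of a cone with vertex `a` to a cone with vertex `(a, x)`. -/
def elCone (M : PseudoFFunctor 𝒜 (chordate Cat.{v₁, u₁})) [∀ a, IsDiscrete (M.obj a)] {a : A}
    (S : Cone 𝒜 J a) (x : M.obj a) :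
    Cone (El.fCategory M.toPseudofunctor 𝒜) J (⟨a, x⟩ : El M.toPseudofunctor) where
  diagram := StrictPseudofunctor.mk''
    { obj := fun j => ⟨S.diagram.obj j, (M.map (S.leg j)).toFunctor.obj x⟩
      map := fun f => El.Hom.mk (S.diagram.map f) ((M.mapCone S).leg_comp_obj f x)
      map₂ := fun θ => El.Hom₂.mk (S.diagram.map₂ θ)
      map₂_id := fun _ => Subsingleton.elim _ _
      map₂_comp := fun _ _ => Subsingleton.elim _ _
      map_id := fun j => El.Hom.ext (S.diagram.map_id j)
      map_comp := fun f g => El.Hom.ext (S.diagram.map_comp f g)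
      map₂_whisker_left := fun _ _ _ _ => Subsingleton.elim _ _
      map₂_whisker_right := fun _ _ => Subsingleton.elim _ _ }
  leg j := El.arrow M (S.leg j) x
  inert_leg j := S.inert_leg j
  inert_diagram f := S.inert_diagram f
  leg_comp f := El.Hom.ext (S.leg_comp f)
  leg_whisker _ := Subsingleton.elim _ _

theorem proj_mapCone_elCone {a : A} (S : Cone 𝒜 J a) (x : M.obj a) :
    (El.proj M.toPseudofunctor 𝒜).mapCone (elCone M S x) = S :=
  cone_ext rfl (fun _ => HEq.rfl)

variable (N : PseudoFFunctor (El.fCategory M.toPseudofunctor 𝒜) (chordate Cat.{v₁, u₁}))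

/-- A compatible family in the disjoint unions has a family of indices, which lifts to a unique
element `x` of the limit of the index sets; it then lies in the diagram of the lift of the cone to
`(a, x)`. -/
theorem isPointwiseLimit_totalFunctor_mapCone {a : A} (S : Cone 𝒜 J a)
    (hM : (M.mapCone S).IsPointwiseLimit)
    (hN : ∀ x : M.obj a, (N.mapCone (elCone M S x)).IsPointwiseLimit) :
    ((totalFunctor N).mapCone S).IsPointwiseLimit where
  existsUnique_obj (y : ∀ j, totalObj N (S.diagram.obj j)) hy hθ := by
    -- The indices of the components of `y` assemble to an element `x` of `M a`.
    obtain ⟨x, hx, -⟩ := hM.existsUnique_obj (fun j => Total.base (y j))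
      (fun f => congrArg Total.base (hy f))
      (fun {j k f g} θ => hom_heq_of_isDiscrete (D := M.obj (S.diagram.obj k))
        (congrArg Total.base (hy f)) (congrArg Total.base (hy g)) _ _)
    have hm : ∀ j, ∃ m : N.obj ((elCone M S x).diagram.obj j),
        (elIncl N ((elCone M S x).diagram.obj j)).toFunctor.obj m = y j := by
      intro j
      have h := hx j
      generalize y j = Y at h ⊢
      obtain ⟨x', m⟩ := Y
      change (M.map (S.leg j)).toFunctor.obj x = x' at h
      subst h
      exact ⟨m, rfl⟩
    choose m hm using hm
    obtain rfl : (fun j => (elIncl N ((elCone M S x).diagram.obj j)).toFunctor.obj (m j)) = y :=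
      funext hm
    have hF : ∀ {j k : J} (f : j ⟶ k),
        (N.map ((elCone M S x).diagram.map f)).toFunctor.obj (m j) = m k := fun {j k} f =>
      totalIncl_obj_injective ((totalMap_obj N ((elCone M S x).diagram.map f) (m j)).symm.trans
        (hy f))
    obtain ⟨n, hn, -⟩ := (hN x).existsUnique_obj m hF (fun {j k f g} θ =>
      (map₂_app_heq_id N.toPseudofunctor ((elCone M S x).diagram.map₂ θ) (m j)).trans
        (congr_arg_heq (fun z => 𝟙 z) (hF f)))
    refine ⟨(elIncl N ⟨a, x⟩).toFunctor.obj n, fun j => congrArg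
      (elIncl N ((elCone M S x).diagram.obj j)).toFunctor.obj (hn j), ?_⟩
    rintro ⟨x', n'⟩ hn'
    obtain rfl : x' = x := hM.obj_ext fun j => congrArg Total.base (hn' j)
    refine congrArg (Total.mk x') ((hN x').obj_ext fun j => ?_)
    exact (totalIncl_obj_injective (hn' j)).trans (hn j).symm
  existsUnique_map X Y γ hγ := by
    obtain ⟨x, n⟩ := X
    obtain ⟨x', n'⟩ := Y
    obtain rfl : x = x' := hM.obj_ext fun j => Total.Hom.base (γ j)
    have hδ : ∀ j, ∃ δ : (N.map ((elCone M S x).leg j)).toFunctor.obj n ⟶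
        (N.map ((elCone M S x).leg j)).toFunctor.obj n',
        (elIncl N ((elCone M S x).diagram.obj j)).toFunctor.map δ = γ j := fun j =>
      totalIncl_map_surjective (γ j)
    choose δ hδ using hδ
    obtain rfl : (fun j => (elIncl N ((elCone M S x).diagram.obj j)).toFunctor.map (δ j)) = γ :=
      funext hδ
    obtain ⟨β, hβ, hu⟩ := (hN x).existsUnique_map n n' δ (fun {j k} f =>
      totalIncl_map_heq_injective ((N.mapCone (elCone M S x)).leg_comp_obj f n)
        ((N.mapCone (elCone M S x)).leg_comp_obj f n')
        ((totalMap_map_heq N ((elCone M S x).diagram.map f) (δ j)).symm.trans (hγ f)))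
    refine ⟨(elIncl N ⟨a, x⟩).toFunctor.map β, fun j => congrArg
      (elIncl N ((elCone M S x).diagram.obj j)).toFunctor.map (hβ j), ?_⟩
    intro β' hβ'
    obtain ⟨β', rfl⟩ := totalIncl_map_surjective β'
    exact congrArg (elIncl N ⟨a, x⟩).toFunctor.map
      (hu β' fun j => totalIncl_map_injective (hβ' j))

end

section

variable {A : Type u} [Bicategory.{w, v} A] [IsLocallyDiscrete A] {𝒜 : FSketch.{wJ, vJ, uJ} A}
  {M : PsModLx 𝒜 (limitSketch.{wJ, vJ, uJ} Cat.{v₁, u₁})} [∀ a, IsDiscrete (M.obj a)]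

/-- The total functor of a pseudo-model on the 2-category of elements, as an object of the slice
over `M`. -/
def totalSlice (N : PsModLx (El.sketch M.toPseudofunctor 𝒜)
    (limitSketch.{wJ, vJ, uJ} Cat.{v₁, u₁})) : Slice M where
  obj :=
    { toPseudoFFunctor := totalFunctor N.toPseudoFFunctor
      marked_mapCone := fun S hS =>
        (isPointwiseLimit_totalFunctor_mapCone N.toPseudoFFunctor S
          (M.marked_mapCone S hS).isPointwiseLimit (fun x =>
            (N.marked_mapCone (elCone M.toPseudoFFunctor S x)
              ((proj_mapCone_elCone (M := M.toPseudoFFunctor) S x).symm ▸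
                hS)).isPointwiseLimit)).isLimit }
  hom := totalTrans N.toPseudoFFunctor

end

/-! ### Strict transformations with invertible components -/

section

variable {B : Type u} [Bicategory.{w, v} B] [Strict B]

theorem comp_square_inv {a b a' b' : B} {f : a ⟶ b} {f' : a' ⟶ b'} {i : a ⟶ a'} {e : a' ⟶ a}
    {i' : b ⟶ b'} {e' : b' ⟶ b} (he : e ≫ i = 𝟙 a') (hi' : i' ≫ e' = 𝟙 b)
    (h : i ≫ f' = f ≫ i') : e ≫ f = f' ≫ e' := by
  rw [← Strict.comp_id f, ← hi', ← Strict.assoc f, ← h, Strict.assoc i, ← Strict.assoc e, he,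
    Strict.id_comp]

theorem square_comp {x x' y y' z z' : B} {p : x ⟶ y} {q : x' ⟶ y'} {r : y ⟶ z} {s : y' ⟶ z'}
    {f : x ⟶ x'} {g : y ⟶ y'} {k : z ⟶ z'} (h₁ : f ≫ q = p ≫ g) (h₂ : g ≫ s = r ≫ k) :
    f ≫ q ≫ s = (p ≫ r) ≫ k := by
  rw [← Strict.assoc, h₁, Strict.assoc, h₂, ← Strict.assoc]

theorem naturality_comp_of_eqToHom {x x' y y' z z' : B} {f : x ⟶ y} {g : y ⟶ z} {k : x ⟶ z}
    {f' : x' ⟶ y'} {g' : y' ⟶ z'} {k' : x' ⟶ z'} {s : x ⟶ x'} {t : y ⟶ y'} {r : z ⟶ z'}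
    {β : f ≫ g ⟶ k} {γ : f' ≫ g' ⟶ k'} (h₁ : s ≫ f' = f ≫ t) (h₂ : t ≫ g' = g ≫ r)
    (h₃ : s ≫ k' = k ≫ r) (h : s ◁ γ ≍ β ▷ r) :
    s ◁ γ ≫ eqToHom h₃ = (α_ s f' g').inv ≫ eqToHom h₁ ▷ g' ≫ (α_ f t g').hom ≫
      f ◁ eqToHom h₂ ≫ (α_ f g r).inv ≫ β ▷ r := by
  refine eq_of_heq ((comp_eqToHom_heq _ _).trans (h.trans ?_))
  simp [Strict.associator_eqToIso]

/-- A 2-cell equation across a square with invertible sides may be read in either direction. -/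
theorem whisker_square_inv_heq {a b a' b' : B} {f g : a ⟶ b} {f' g' : a' ⟶ b'} {β : f ⟶ g}
    {γ : f' ⟶ g'} {i : a ⟶ a'} {e : a' ⟶ a} {i' : b ⟶ b'} {e' : b' ⟶ b} (he : e ≫ i = 𝟙 a')
    (hi' : i' ≫ e' = 𝟙 b) (hf : i ≫ f' = f ≫ i') (hg : i ≫ g' = g ≫ i')
    (h : i ◁ γ ≍ β ▷ i') : e ◁ β ≍ γ ▷ e' := by
  have hs : ∀ {k : a ⟶ b} {k' : a' ⟶ b'}, i ≫ k' = k ≫ i' → k = i ≫ k' ≫ e' :=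
    fun {k k'} h => by rw [← Strict.assoc, h, Strict.assoc, hi', Strict.comp_id]
  have h₁ : β ≍ i ◁ γ ▷ e' :=
    ((whiskerRight_id_heq β).symm.trans (whiskerRight_heq rfl rfl hi'.symm HEq.rfl)).trans
      ((whiskerRight_comp_heq β i' e').trans
        ((whiskerRight_heq hf.symm hg.symm rfl h.symm).trans (whisker_assoc_heq i γ e')))
  refine (whiskerLeft_heq rfl (hs hf) (hs hg) h₁).trans
    ((comp_whiskerLeft_heq e i _).symm.trans ?_)
  exact (whiskerLeft_heq he rfl rfl HEq.rfl).trans (id_whiskerLeft_heq _)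

end

section

variable {A : Type u₁} [Bicategory.{w₁, v₁} A] {B : Type u₂} [Bicategory.{w₂, v₂} B] [Strict B]

/-- Lax-`ℱ`-transformations whose naturality 2-cells are identities are determined by their
components. -/
theorem LaxFTrans.eq_of_strict [Strict A] {𝒜 : FCategory A} {ℬ : FCategory B}
    {F G : PseudoFFunctor 𝒜 ℬ} {η θ : LaxFTrans F G} (h : ∀ a, η.app a = θ.app a)
    (hη : ∀ {a b : A} (f : a ⟶ b), ∃ e, η.naturality f = eqToHom e)
    (hθ : ∀ {a b : A} (f : a ⟶ b), ∃ e, θ.naturality f = eqToHom e) : η = θ := by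
  obtain ⟨⟨p, m, _, _, _⟩, _⟩ := η
  obtain ⟨⟨q, n, _, _, _⟩, _⟩ := θ
  obtain rfl : p = q := funext h
  obtain rfl : @m = @n := by
    funext a b f
    obtain ⟨_, e₁⟩ := hη f
    obtain ⟨_, e₂⟩ := hθ f
    exact e₁.trans e₂.symm
  rfl

theorem LaxFTrans.comp_eq_id_of_strict [Strict A] {𝒜 : FCategory A} {ℬ : FCategory B}
    {F G : PseudoFFunctor 𝒜 ℬ} {η : LaxFTrans F G} {θ : LaxFTrans G F}
    (h : ∀ a, η.app a ≫ θ.app a = 𝟙 (F.obj a))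
    (hη : ∀ {a b : A} (f : a ⟶ b), ∃ e, η.naturality f = eqToHom e)
    (hθ : ∀ {a b : A} (f : a ⟶ b), ∃ e, θ.naturality f = eqToHom e) :
    η.comp θ = LaxFTrans.id F :=
  LaxFTrans.eq_of_strict h
    (fun {a b} f => by
      obtain ⟨h₁, e₁⟩ := hη f
      obtain ⟨h₂, e₂⟩ := hθ f
      refine ⟨comp_square h₁ h₂, ?_⟩
      change Lax.LaxTrans.vCompNaturality η.toLaxTrans θ.toLaxTrans f = _
      rw [Lax.LaxTrans.vCompNaturality, e₁, e₂]
      exact comp_square_eqToHom h₁ h₂)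
    (fun f => ⟨_, unitors_eqToHom (F.map f)⟩)

variable [IsLocallyDiscrete A] {𝒜 : FCategory A} {ℬ : FCategory B} {F G : PseudoFFunctor 𝒜 ℬ}

/-- A strictly natural family of 1-cells that is compatible with the compositors, as a
lax-`ℱ`-transformation. -/
def LaxFTrans.ofStrict (s : ∀ a, F.obj a ⟶ G.obj a)
    (h : ∀ {a b : A} (f : a ⟶ b), s a ≫ G.map f = F.map f ≫ s b)
    (h' : ∀ {a b c : A} (f : a ⟶ b) (g : b ⟶ c),
      s a ◁ (G.mapComp f g).inv ≍ (F.mapComp f g).inv ▷ s c) : LaxFTrans F G where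
  app := s
  naturality f := eqToHom (h f)
  naturality_naturality {a b f g} α := by
    obtain rfl := obj_ext_of_isDiscrete α
    obtain rfl := Subsingleton.elim α (𝟙 f)
    exact naturality_map₂_id (eqToHom (h f))
  naturality_id a := naturality_id_of_eqToHom (h (𝟙 a))
  naturality_comp {a b c} f g := naturality_comp_of_eqToHom (h f) (h g) (h (f ≫ g)) (h' f g)
  naturality_of_inert f _ := ⟨h f, rfl⟩

end

section

variable {C D : Cat.{v, u}}

/-- A functor that is bijective on objects and on hom-sets is an isomorphism of categories. -/
theorem exists_inv_of_bijective (F : C ⟶ D) (hobj : Function.Bijective F.toFunctor.obj)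
    (hmap : ∀ x y : C, Function.Bijective (fun f : x ⟶ y => F.toFunctor.map f)) :
    ∃ G : D ⟶ C, G ≫ F = 𝟙 D ∧ F ≫ G = 𝟙 C := by
  choose o ho using hobj.2
  have hm : ∀ {x y : D} (g : x ⟶ y), ∃ f : o x ⟶ o y, F.toFunctor.map f ≍ g := by
    intro x y g
    obtain ⟨f, hf⟩ := (hmap (o x) (o y)).2 (eqToHom (ho x) ≫ g ≫ eqToHom (ho y).symm)
    exact ⟨f, (heq_of_eq hf).trans ((eqToHom_comp_heq _ _).trans (comp_eqToHom_heq _ _))⟩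
  choose m hm using @hm
  have hinj : ∀ {x y x' y' : C} {f : x ⟶ y} {g : x' ⟶ y'}, x = x' → y = y' →
      F.toFunctor.map f ≍ F.toFunctor.map g → f ≍ g := by
    rintro x y _ _ f g rfl rfl h
    exact heq_of_eq ((hmap x y).1 (eq_of_heq h))
  let G : D ⟶ C := Cat.Hom.ofFunctor
    { obj := o
      map := fun g => m g
      map_id := fun x => eq_of_heq (hinj rfl rfl ((hm (𝟙 x)).trans (by
        rw [CategoryTheory.Functor.map_id, ho])))
      map_comp := fun {x y z} f g => eq_of_heq (hinj rfl rfl ((hm (f ≫ g)).trans (by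
        rw [CategoryTheory.Functor.map_comp]
        exact heq_comp (ho x).symm (ho y).symm (ho z).symm (hm f).symm (hm g).symm))) }
  refine ⟨G, cat_hom_hext ho (fun _ _ g => hm g), ?_⟩
  have ho' : ∀ x : C, o (F.toFunctor.obj x) = x := fun x => hobj.1 (ho _)
  exact cat_hom_hext ho' (fun x y f => hinj (ho' x) (ho' y) (hm _))

end

/-! ### The fibres of the total functor -/

section

variable {A : Type u} [Bicategory.{w, v} A] [IsLocallyDiscrete A]
  {𝒜 : FCategory A} {M : PseudoFFunctor 𝒜 (chordate Cat.{v₁, u₁})}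
  [∀ a, IsDiscrete (M.obj a)]
  (N : PseudoFFunctor (El.fCategory M.toPseudofunctor 𝒜) (chordate Cat.{v₁, u₁}))

/-- The functor from `N (a, x)` to the fibre of the disjoint union over `x`. -/
def toFiber (Y : El M.toPseudofunctor) :
    N.obj Y ⟶ fiberCat ((totalTrans N).app Y.base) Y.elt :=
  Cat.Hom.ofFunctor
    { obj := fun m => ⟨(elIncl N Y).toFunctor.obj m, rfl⟩
      map := fun f => (elIncl N Y).toFunctor.map f
      map_id := fun _ => rfl
      map_comp := fun _ _ => rfl }

variable {N} in
theorem exists_elIncl_eq {a : A} {x : M.obj a} (X : totalObj N a) (h : Total.base X = x) :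
    ∃ m, (elIncl N ⟨a, x⟩).toFunctor.obj m = X := by
  subst h
  exact ⟨Total.pt X, rfl⟩

theorem exists_toFiber_inv (Y : El M.toPseudofunctor) :
    ∃ e : fiberCat ((totalTrans N).app Y.base) Y.elt ⟶ N.obj Y,
      e ≫ toFiber N Y = 𝟙 _ ∧ toFiber N Y ≫ e = 𝟙 _ := by
  refine exists_inv_of_bijective _ ⟨fun m n h => ?_, fun p => ?_⟩
    (fun m n => ⟨fun f g h => ?_, fun f => ?_⟩)
  · exact totalIncl_obj_injective (congrArg Fiber.pt h)
  · obtain ⟨m, hm⟩ := exists_elIncl_eq (x := Y.elt) (Fiber.pt p) (Fiber.mem p)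
    exact ⟨m, Fiber.ext hm⟩
  · exact totalIncl_map_injective h
  · exact totalIncl_map_surjective f

theorem toFiber_naturality {Y Z : El M.toPseudofunctor} (F : Y ⟶ Z) :
    toFiber N Y ≫ (fiberFunctor (totalTrans N)).map F = N.map F ≫ toFiber N Z := by
  obtain ⟨a, x⟩ := Y
  obtain ⟨b, y⟩ := Z
  obtain ⟨f, h⟩ := F
  change a ⟶ b at f
  change (M.map f).toFunctor.obj x = y at h
  subst h
  rfl

theorem toFiber_mapComp_heq {Y Z W : El M.toPseudofunctor} (F : Y ⟶ Z) (G : Z ⟶ W) :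
    toFiber N Y ◁ ((fiberFunctor (totalTrans N)).mapComp F G).inv ≍
      (N.mapComp F G).inv ▷ toFiber N W := by
  refine cat_hom₂_hext ?_ (toFiber_naturality N (F ≫ G)) fun m => ?_
  · exact square_comp (toFiber_naturality N F) (toFiber_naturality N G)
  · exact totalCompInv_heq N F G m

/-- The comparison from a pseudo-`ℱ`-functor to the fibres of its total functor. -/
def toFiberTrans : LaxFTrans N (fiberFunctor (totalTrans N)) :=
  LaxFTrans.ofStrict (toFiber N) (fun F => toFiber_naturality N F)
    (fun F G => toFiber_mapComp_heq N F G)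

/-- The inverse of `toFiber`. -/
noncomputable def ofFiber (Y : El M.toPseudofunctor) :
    fiberCat ((totalTrans N).app Y.base) Y.elt ⟶ N.obj Y :=
  (exists_toFiber_inv N Y).choose

theorem ofFiber_toFiber (Y : El M.toPseudofunctor) : ofFiber N Y ≫ toFiber N Y = 𝟙 _ :=
  (exists_toFiber_inv N Y).choose_spec.1

theorem toFiber_ofFiber (Y : El M.toPseudofunctor) : toFiber N Y ≫ ofFiber N Y = 𝟙 _ :=
  (exists_toFiber_inv N Y).choose_spec.2

theorem ofFiber_naturality {Y Z : El M.toPseudofunctor} (F : Y ⟶ Z) :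
    ofFiber N Y ≫ N.map F = (fiberFunctor (totalTrans N)).map F ≫ ofFiber N Z :=
  comp_square_inv (ofFiber_toFiber N Y) (toFiber_ofFiber N Z) (toFiber_naturality N F)

/-- The inverse of the comparison from a pseudo-`ℱ`-functor to the fibres of its total functor. -/
noncomputable def ofFiberTrans : LaxFTrans (fiberFunctor (totalTrans N)) N :=
  LaxFTrans.ofStrict (ofFiber N)
    (fun F => ofFiber_naturality N F)
    (fun {Y _ W} F G => whisker_square_inv_heq (ofFiber_toFiber N Y) (toFiber_ofFiber N W)
      (square_comp (toFiber_naturality N F) (toFiber_naturality N G))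
      (toFiber_naturality N (F ≫ G)) (toFiber_mapComp_heq N F G))

theorem toFiberTrans_comp_ofFiberTrans :
    (toFiberTrans N).comp (ofFiberTrans N) = LaxFTrans.id N :=
  LaxFTrans.comp_eq_id_of_strict (toFiber_ofFiber N) (fun F => ⟨toFiber_naturality N F, rfl⟩)
    (fun F => ⟨ofFiber_naturality N F, rfl⟩)

theorem ofFiberTrans_comp_toFiberTrans :
    (ofFiberTrans N).comp (toFiberTrans N) = LaxFTrans.id (fiberFunctor (totalTrans N)) :=
  LaxFTrans.comp_eq_id_of_strict (ofFiber_toFiber N) (fun F => ⟨ofFiber_naturality N F, rfl⟩)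
    (fun F => ⟨toFiber_naturality N F, rfl⟩)

end

section

variable {A : Type u} [Bicategory.{w, v} A] [IsLocallyDiscrete A] {𝒜 : FSketch.{wJ, vJ, uJ} A}
  (M : PsModLx 𝒜 (limitSketch.{wJ, vJ, uJ} Cat.{v₁, u₁})) [∀ a, IsDiscrete (M.obj a)]

/-- Every pseudo-model on the 2-category of elements is isomorphic to the fibres of its total
functor. -/
noncomputable def isoSectionFiberTwoFunctor : IsoSection (fiberTwoFunctor M) where
  obj := totalSlice
  hom N := ofFiberTrans N.toPseudoFFunctor
  inv N := toFiberTrans N.toPseudoFFunctor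
  hom_inv N := ofFiberTrans_comp_toFiberTrans N.toPseudoFFunctor
  inv_hom N := toFiberTrans_comp_ofFiberTrans N.toPseudoFFunctor

end

end EnhancedSketch

theorem mainTheorem4 {A : Type u} [Bicategory.{w, v} A]
    [IsLocallyDiscrete A] (𝒜 : EnhancedSketch.FSketch.{wJ, vJ, uJ} A)
    (M : EnhancedSketch.PsModLx 𝒜
      (EnhancedSketch.limitSketch.{wJ, vJ, uJ} Cat.{v₁, u₁}))
    [∀ a : A, IsDiscrete (M.obj a)] :
    Nonempty (EnhancedSketch.TwoEquivalence
      (EnhancedSketch.Slice M)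
      (EnhancedSketch.PsModLx (EnhancedSketch.El.sketch M.toPseudofunctor 𝒜)
        (EnhancedSketch.limitSketch.{wJ, vJ, uJ} Cat.{v₁, u₁}))) :=
  ⟨(EnhancedSketch.isoSectionFiberTwoFunctor M).twoEquivalence
    EnhancedSketch.isLocalIso_fiberTwoFunctor⟩
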